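/- All graphs are finite and simple. For a graph $G$ on $n$ vertices let $\phi(m,G)$ be the number of $m$-matchings of $G$, i.e. of sets of $m$ distinct edges no two of which share a vertex (so $\phi(0,G)=1$), and let $\Phi_G(x)=\sum_{m=0}^{\lfloor n/2\rfloor}\phi(m,G)x^m$. For real polynomials $f,g$ write $f\preceq g$ if all coefficients of $g-f$ are nonnegative, and $f\prec g$ if $f\preceq g$ and $f\neq g$. Let $P_i$ and $C_i$ be the path and the cycle on $i$ vertices, $\cup$ the disjoint union, and $qG$ the disjoint union of $q$ copies of $G$. Graphs are considered up to isomorphism. Let $2\le 2k\le n$, let $\Omega(n,k)$ be the set of graphs on $n$ vertices of which exactly $2k$ have degree $1$ and the other $l=n-2k$ have degree $2$. If $l<2$, then $\Omega(n,k)$ consists of exactly one graph. If $l\ge 2$, then for every $G\in\Omega(n,k)$ $$\Phi_F\preceq\Phi_G\preceq\Phi_H ,$$ where $F,H\in\Omega(n,k)$ are as follows. 1. If $l\le k$, then $F=lP_3\cup(k-l)P_2$. 2. If $l>k$: (a) if $l-k\equiv 0\pmod 3$, then $F=kP_3\cup\frac{l-k}{3}C_3$; (b) if $l-k\equiv 1\pmod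 3$, then $F=(k-1)P_3\cup P_4\cup\frac{l-k-1}{3}C_3$; (c) if $l-k\equiv 2\pmod 3$, then $F$ is either of $F_1=(k-1)P_3\cup P_5\cup\frac{l-k-2}{3}C_3$ and $F_2=(k-1)P_3\cup P_2\cup\frac{l-k+1}{3}C_3$. 3. If $l=2$, then $H=(k-1)P_2\cup P_4$. 4. If $l=3$, then $H$ is either of $(k-1)P_2\cup P_5$ and $kP_2\cup C_3$. 5. If $l\ge4$ and $l\equiv0\pmod4$, then $H=kP_2\cup\frac{l}{4}C_4$. 6. If $l\ge5$ and $l\equiv1\pmod4$, then $H=kP_2\cup\frac{l-5}{4}C_4\cup C_5$. 7. If $l\ge6$ and $l\equiv2\pmod4$, then $H=kP_2\cup\frac{l-6}{4}C_4\cup C_6$. 8. If $l\ge7$ and $l\equiv3\pmod4$, then $H=kP_2\cup\frac{l-7}{4}C_4\cup C_7$. In particular $\phi(m,F)\le\phi(m,G)\le\phi(m,H)$ for every $m$, so $F$ and $H$ minimize and maximize every $\phi(m,\cdot)$ over $\Omega(n,k)$. Furthermore, if $G$ is not (one of) the graph(s) listed as $F$, then $\Phi_F\prec\Phi_G$, and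 if $G$ is not (one of) the graph(s) listed as $H$, then $\Phi_G\prec\Phi_H$. (In the cases 2(c) and 4, where two graphs are listed, all of this holds for either choice.) -/

import Mathlib

/-- The `m`-matchings of `G`: sets of `m` distinct edges, no two of which have a common vertex. -/
def mMatchings {V : Type*} (m : ℕ) (G : SimpleGraph V) : Set (Finset (Sym2 V)) :=
  {M | (∀ e ∈ M, e ∈ G.edgeSet) ∧ M.card = m ∧
    ∀ e ∈ M, ∀ f ∈ M, e ≠ f → ∀ v : V, ¬ (v ∈ e ∧ v ∈ f)}

/-- `φ(m, G)`, the number of `m`-matchings of `G`. -/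
noncomputable def numMatchings {V : Type*} (m : ℕ) (G : SimpleGraph V) : ℕ :=
  (mMatchings m G).ncard

/-- The generating matching polynomial `Φ_G(x) = ∑_{m=0}^{⌊n/2⌋} φ(m, G) x^m`, where `n` is the
number of vertices of `G`. -/
noncomputable def matchingGenPoly {V : Type*} [Fintype V] (G : SimpleGraph V) : Polynomial ℝ :=
  ∑ m ∈ Finset.range (Fintype.card V / 2 + 1),
    Polynomial.C (numMatchings m G : ℝ) * Polynomial.X ^ m

/-- `f ⪯ g`: all coefficients of `g - f` are nonnegative. -/
def CoeffLE (f g : Polynomial ℝ) : Prop := ∀ i, 0 ≤ (g - f).coeff i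

/-- `f ≺ g`: `f ⪯ g` and `f ≠ g`. -/
def CoeffLT (f g : Polynomial ℝ) : Prop := CoeffLE f g ∧ f ≠ g

open Classical in
/-- Membership in `Ω(n, k)`: `G` is a simple graph with `n` vertices, exactly `2k` of which have
degree `1`, all the others having degree `2`. -/
def InOmega (n k : ℕ) {V : Type*} [Fintype V] (G : SimpleGraph V) : Prop :=
  Fintype.card V = n ∧
  (Finset.univ.filter fun v : V => G.degree v = 1).card = 2 * k ∧
  ∀ v : V, G.degree v = 1 ∨ G.degree v = 2

/-- A finite simple graph bundled with its vertex type. -/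
structure FinGraph where
  V : Type
  [fintypeV : Fintype V]
  graph : SimpleGraph V

attribute [instance] FinGraph.fintypeV

namespace FinGraph

/-- The path `P_m` on `m` vertices. -/
def P (m : ℕ) : FinGraph := ⟨Fin m, SimpleGraph.pathGraph m⟩

/-- The cycle `C_m` on `m` vertices (used for `m ≥ 3` only). -/
def C (m : ℕ) : FinGraph := ⟨Fin m, SimpleGraph.cycleGraph m⟩

/-- `F ∪ H` is the disjoint union of two graphs. -/
instance : Union FinGraph := ⟨fun F H => ⟨F.V ⊕ H.V, F.graph ⊕g H.graph⟩⟩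

/-- The disjoint union of `q` copies of a graph. -/
def copies : ℕ → FinGraph → FinGraph
  | 0, _ => ⟨Empty, ⊥⟩
  | q + 1, F => copies q F ∪ F

/-- `q • F` is the disjoint union of `q` copies of `F`. -/
instance : SMul ℕ FinGraph := ⟨copies⟩

/-- The graphs `F` for the parameters `l = n - 2k` and `k`. -/
def minGraphs (l k : ℕ) : Set FinGraph :=
  if l ≤ k then {l • P 3 ∪ (k - l) • P 2}
  else if (l - k) % 3 = 0 then {k • P 3 ∪ ((l - k) / 3) • C 3}
  else if (l - k) % 3 = 1 then {(k - 1) • P 3 ∪ P 4 ∪ ((l - k - 1) / 3) • C 3}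
  else {(k - 1) • P 3 ∪ P 5 ∪ ((l - k - 2) / 3) • C 3,
        (k - 1) • P 3 ∪ P 2 ∪ ((l - k + 1) / 3) • C 3}

/-- The graphs `H` for the parameters `l = n - 2k ≥ 2` and `k`. -/
def maxGraphs (l k : ℕ) : Set FinGraph :=
  if l = 2 then {(k - 1) • P 2 ∪ P 4}
  else if l = 3 then {(k - 1) • P 2 ∪ P 5, k • P 2 ∪ C 3}
  else if l % 4 = 0 then {k • P 2 ∪ (l / 4) • C 4}
  else if l % 4 = 1 then {k • P 2 ∪ ((l - 5) / 4) • C 4 ∪ C 5}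
  else if l % 4 = 2 then {k • P 2 ∪ ((l - 6) / 4) • C 4 ∪ C 6}
  else {k • P 2 ∪ ((l - 7) / 4) • C 4 ∪ C 7}

/-- `G` is (isomorphic to) one of the graphs in the family `S`. -/
def IsOneOf {V : Type*} (G : SimpleGraph V) (S : Set FinGraph) : Prop :=
  ∃ F ∈ S, Nonempty (G ≃g F.graph)

end FinGraph

/-! A finite graph whose degrees are all 1 or 2 is a disjoint union of paths with at least two
vertices and cycles. The paths account for the degree-1 vertices, two each, so membership in `Ω(n,
k)` means `k` paths, any number of cycles, and `n` vertices in total (`InOmega.exists_isModel`,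
`IsModel.inOmega`).

The matching polynomial is multiplicative over components (`graphPoly_sum`). Hence a few components
may be exchanged for others with as many vertices and as many paths: the graph stays in `Ω(n, k)`,
and the polynomial changes by the local difference times the nonzero polynomial of the untouched
components. It suffices to compare small unions coefficientwise, and each comparison is an identity
whose remainder has natural coefficients. Such remainders come from the common recurrence `f (n+2) =
f (n+1) + X * f n` of paths and cycles: splitting off a cycle of order 3 lowers the polynomial,
splitting off one of order 4 raises it.

A graph that no exchange lowers is a listed `F` (`exists_minGraph_or_canLower`), and one that no
exchange raises is a listed `H` (`exists_maxGraph_or_canRaise`). Every exchange strictly changes the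
total number of matchings, the value of the polynomial at 1. This number is natural and at most `4 ^
n`, so repeated exchanges end at a listed graph, and any graph needing at least one exchange
compares strictly. Where two graphs are listed, their polynomials agree because `P 5` and `P 2 ∪ C
3` have the same one (`pathPoly_five`). -/

open Polynomial

/-! ### Matching polynomials of finite edge sets. -/

/-- Two edges are apart if they have no common vertex. -/
def Sym2.Apart {α : Type*} (e f : Sym2 α) : Prop := ∀ v : α, ¬ (v ∈ e ∧ v ∈ f)

theorem Sym2.Apart.symm {α : Type*} {e f : Sym2 α} (h : e.Apart f) : f.Apart e :=
  fun v hv => h v hv.symm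

theorem Sym2.not_apart_self {α : Type*} (e : Sym2 α) : ¬ e.Apart e := by
  induction e with
  | _ a b => exact fun h => h a (by simp)

theorem Sym2.apart_map {α β : Type*} {f : α → β} (hf : Function.Injective f) {d e : Sym2 α} :
    (d.map f).Apart (e.map f) ↔ d.Apart e := by
  constructor
  · intro h v hv
    exact h (f v) ⟨Sym2.mem_map.2 ⟨v, hv.1, rfl⟩, Sym2.mem_map.2 ⟨v, hv.2, rfl⟩⟩
  · rintro h v ⟨h1, h2⟩
    obtain ⟨a, ha, rfl⟩ := Sym2.mem_map.1 h1
    obtain ⟨b, hb, hab⟩ := Sym2.mem_map.1 h2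
    exact h a ⟨ha, hf hab ▸ hb⟩

/-- A set of pairwise apart edges. -/
def IsMatchingSet {α : Type*} (M : Finset (Sym2 α)) : Prop :=
  ∀ e ∈ M, ∀ f ∈ M, e ≠ f → e.Apart f

open Classical in
/-- The generating polynomial of the matchings contained in a finite set of edges. -/
noncomputable def matchPoly {α : Type*} (E : Finset (Sym2 α)) : ℕ[X] :=
  ∑ M ∈ E.powerset.filter IsMatchingSet, X ^ M.card

theorem matchPoly_empty {α : Type*} : matchPoly (∅ : Finset (Sym2 α)) = 1 := by
  classical
  have : (∅ : Finset (Sym2 α)).powerset.filter IsMatchingSet = {∅} := by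
    ext M
    simp only [Finset.powerset_empty, Finset.mem_filter, Finset.mem_singleton,
      and_iff_left_iff_imp]
    rintro rfl
    simp [IsMatchingSet]
  rw [matchPoly, this]
  simp

/-- Matchings avoiding `e`, and matchings containing `e`. -/
theorem matchPoly_insert {α : Type*} [DecidableEq α] {E : Finset (Sym2 α)} {e : Sym2 α}
    [DecidablePred e.Apart] (he : e ∉ E) :
    matchPoly (insert e E) = matchPoly E + X * matchPoly (E.filter e.Apart) := by
  classical
  -- Deleting `e` identifies the matchings through `e` with the matchings among the edges apart from
  -- `e`.
  have key : (E.filter e.Apart).powerset.filter IsMatchingSet =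
      E.powerset.filter fun M => IsMatchingSet (insert e M) := by
    ext M
    simp only [Finset.mem_filter, Finset.mem_powerset, Finset.subset_iff]
    constructor
    · rintro ⟨h1, h2⟩
      refine ⟨fun x hx => (h1 hx).1, ?_⟩
      intro a ha b hb hab
      rcases Finset.mem_insert.1 ha with ha' | ha'
      · rcases Finset.mem_insert.1 hb with hb' | hb'
        · exact absurd (ha'.trans hb'.symm) hab
        · exact ha' ▸ (h1 hb').2
      · rcases Finset.mem_insert.1 hb with hb' | hb'
        · exact hb' ▸ (h1 ha').2.symm
        · exact h2 a ha' b hb' hab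
    · rintro ⟨h1, h2⟩
      refine ⟨fun x hx => ⟨h1 hx, h2 e (Finset.mem_insert_self _ _) x
        (Finset.mem_insert_of_mem hx) ?_⟩, ?_⟩
      · rintro rfl
        exact he (h1 hx)
      · intro a ha b hb
        exact h2 a (Finset.mem_insert_of_mem ha) b (Finset.mem_insert_of_mem hb)
  unfold matchPoly
  rw [key, Finset.sum_filter, Finset.sum_powerset_insert he, Finset.sum_filter, Finset.sum_filter,
    Finset.mul_sum]
  congr 1
  refine Finset.sum_congr rfl fun M hM => ?_
  have : e ∉ M := fun h => he (Finset.mem_powerset.1 hM h)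
  split_ifs
  · rw [Finset.card_insert_of_notMem this, pow_succ, mul_comm]
  · simp

/-- Induction on `F`: every edge of `E` is apart from the removed edge `f`, so both terms of
`matchPoly_insert` keep `E` whole and shrink only `F`. -/
theorem matchPoly_union {α : Type*} [DecidableEq α] (E F : Finset (Sym2 α))
    (h : ∀ e ∈ E, ∀ f ∈ F, e.Apart f) : matchPoly (E ∪ F) = matchPoly E * matchPoly F := by
  classical
  induction hn : F.card using Nat.strong_induction_on generalizing F with
  | _ n ih =>
    rcases F.eq_empty_or_nonempty with rfl | ⟨f, hf⟩
    · simp [matchPoly_empty]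
    · obtain ⟨F, hfF, rfl⟩ : ∃ F', f ∉ F' ∧ F = insert f F' :=
        ⟨F.erase f, Finset.notMem_erase _ _, (Finset.insert_erase hf).symm⟩
      rw [Finset.card_insert_of_notMem hfF] at hn
      have hfE : f ∉ E := fun hE => f.not_apart_self (h f hE f hf)
      have h1 := ih F.card (by omega) F
        (fun e he g hg => h e he g (Finset.mem_insert_of_mem hg)) rfl
      have h2 := ih _ (lt_of_le_of_lt (Finset.card_filter_le F f.Apart) (by omega))
        (F.filter f.Apart) (fun e he g hg =>
          h e he g (Finset.mem_insert_of_mem (Finset.mem_filter.1 hg).1)) rfl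
      have h3 : E.filter f.Apart = E :=
        Finset.filter_true_of_mem fun e he => (h e he f hf).symm
      rw [Finset.union_insert, matchPoly_insert (by simp [hfE, hfF]), matchPoly_insert hfF,
        Finset.filter_union, h3, h1, h2]
      ring

theorem matchPoly_image {α β : Type*} [DecidableEq β] {f : α → β} (hf : Function.Injective f)
    (E : Finset (Sym2 α)) : matchPoly (E.image (Sym2.map f)) = matchPoly E := by
  classical
  induction hn : E.card using Nat.strong_induction_on generalizing E with
  | _ n ih =>
    rcases E.eq_empty_or_nonempty with rfl | ⟨e, he⟩
    · simp [matchPoly_empty]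
    · obtain ⟨E, heE, rfl⟩ : ∃ E', e ∉ E' ∧ E = insert e E' :=
        ⟨E.erase e, Finset.notMem_erase _ _, (Finset.insert_erase he).symm⟩
      rw [Finset.card_insert_of_notMem heE] at hn
      have h1 := ih E.card (by omega) E rfl
      have h2 := ih _ (lt_of_le_of_lt (Finset.card_filter_le E e.Apart) (by omega))
        (E.filter e.Apart) rfl
      have h3 : (E.image (Sym2.map f)).filter (e.map f).Apart =
          (E.filter e.Apart).image (Sym2.map f) := by
        rw [Finset.filter_image]
        simp only [Sym2.apart_map hf]
      rw [Finset.image_insert, matchPoly_insert, matchPoly_insert heE, h3, h1, h2]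
      simpa [(Sym2.map.injective hf).eq_iff] using heE

/-! ### Matching polynomials of graphs. -/

/-- The generating matching polynomial with natural coefficients. -/
noncomputable def graphPoly {V : Type*} [Finite V] (G : SimpleGraph V) : ℕ[X] :=
  matchPoly (Set.toFinite G.edgeSet).toFinset

/-- Vertices may be relabelled injectively in any type. This yields isomorphism invariance, and lets
paths and cycles of all orders share the labels `ℕ`. -/
theorem graphPoly_eq_matchPoly {V α : Type*} [Finite V] (G : SimpleGraph V) {f : V → α}
    (hf : Function.Injective f) (E : Finset (Sym2 α))
    (hE : ∀ a b, s(a, b) ∈ E ↔ ∃ u v, G.Adj u v ∧ f u = a ∧ f v = b) :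
    graphPoly G = matchPoly E := by
  classical
  have : E = (Set.toFinite G.edgeSet).toFinset.image (Sym2.map f) := by
    ext e
    induction e with
    | _ a b =>
      rw [hE]
      simp only [Finset.mem_image, Set.Finite.mem_toFinset]
      constructor
      · rintro ⟨u, v, h, rfl, rfl⟩
        exact ⟨s(u, v), h, by simp⟩
      · rintro ⟨d, hd, hd'⟩
        induction d with
        | _ u v =>
          rw [SimpleGraph.mem_edgeSet] at hd
          rw [Sym2.map_mk, Sym2.eq_iff] at hd'
          rcases hd' with ⟨h1, h2⟩ | ⟨h1, h2⟩
          · exact ⟨u, v, hd, h1, h2⟩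
          · exact ⟨v, u, hd.symm, h2, h1⟩
  rw [this, matchPoly_image hf, graphPoly]

theorem graphPoly_congr {V W : Type*} [Finite V] [Finite W] {G : SimpleGraph V}
    {H : SimpleGraph W} (e : G ≃g H) : graphPoly G = graphPoly H := by
  refine graphPoly_eq_matchPoly G e.injective _ fun a b => ?_
  simp only [Set.Finite.mem_toFinset, SimpleGraph.mem_edgeSet]
  constructor
  · intro h
    exact ⟨e.symm a, e.symm b, e.symm.map_adj_iff.2 h, by simp, by simp⟩
  · rintro ⟨u, v, h, rfl, rfl⟩
    exact e.map_adj_iff.2 h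

theorem graphPoly_sum {V W : Type*} [Finite V] [Finite W] (G : SimpleGraph V)
    (H : SimpleGraph W) : graphPoly (G ⊕g H) = graphPoly G * graphPoly H := by
  classical
  rw [graphPoly_eq_matchPoly (G ⊕g H) Function.injective_id
    ((Set.toFinite G.edgeSet).toFinset.image (Sym2.map Sum.inl) ∪
      (Set.toFinite H.edgeSet).toFinset.image (Sym2.map Sum.inr)), matchPoly_union,
    matchPoly_image Sum.inl_injective, matchPoly_image Sum.inr_injective, graphPoly, graphPoly]
  · simp only [Finset.mem_image]
    rintro _ ⟨e, -, rfl⟩ _ ⟨f, -, rfl⟩ v ⟨h1, h2⟩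
    obtain ⟨a, -, rfl⟩ := Sym2.mem_map.1 h1
    obtain ⟨b, -, hb⟩ := Sym2.mem_map.1 h2
    cases hb
  · intro a b
    simp only [Finset.mem_union, Finset.mem_image, Set.Finite.mem_toFinset, Sym2.exists,
      SimpleGraph.mem_edgeSet, Sym2.map_mk, Sym2.eq_iff, id]
    constructor
    · rintro (⟨u, v, h, ⟨rfl, rfl⟩ | ⟨rfl, rfl⟩⟩ | ⟨u, v, h, ⟨rfl, rfl⟩ | ⟨rfl, rfl⟩⟩)
      · exact ⟨_, _, SimpleGraph.sum_adj_inl.2 h, rfl, rfl⟩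
      · exact ⟨_, _, SimpleGraph.sum_adj_inl.2 h.symm, rfl, rfl⟩
      · exact ⟨_, _, SimpleGraph.sum_adj_inr.2 h, rfl, rfl⟩
      · exact ⟨_, _, SimpleGraph.sum_adj_inr.2 h.symm, rfl, rfl⟩
    · rintro ⟨u | u, v | v, h, rfl, rfl⟩
      · exact Or.inl ⟨u, v, SimpleGraph.sum_adj_inl.1 h, Or.inl ⟨rfl, rfl⟩⟩
      · simp at h
      · simp at h
      · exact Or.inr ⟨u, v, SimpleGraph.sum_adj_inr.1 h, Or.inl ⟨rfl, rfl⟩⟩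

theorem coeff_graphPoly {V : Type*} [Finite V] (G : SimpleGraph V) (m : ℕ) :
    (graphPoly G).coeff m = numMatchings m G := by
  classical
  rw [graphPoly, matchPoly, finsetSum_coeff, numMatchings]
  simp only [coeff_X_pow]
  rw [← Finset.sum_filter, Finset.sum_const, smul_eq_mul, mul_one, ← Set.ncard_coe_finset]
  congr 1
  ext M
  simp only [Finset.coe_filter, Finset.mem_filter, Finset.mem_powerset, Finset.subset_iff,
    Set.Finite.mem_toFinset, Set.mem_ofPred_eq, mMatchings, IsMatchingSet, Sym2.Apart]
  constructor
  · rintro ⟨⟨h1, h2⟩, h3⟩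
    exact ⟨h1, h3.symm, h2⟩
  · rintro ⟨h1, h2, h3⟩
    exact ⟨⟨h1, h3⟩, h2.symm⟩

/-- A matching on `n` vertices has at most `n / 2` edges. -/
theorem numMatchings_eq_zero {V : Type*} [Fintype V] (G : SimpleGraph V) {m : ℕ}
    (hm : Fintype.card V < 2 * m) : numMatchings m G = 0 := by
  classical
  rw [numMatchings, Set.ncard_eq_zero (Set.toFinite _)]
  refine Set.eq_empty_of_forall_notMem ?_
  rintro M ⟨h1, h2, h3⟩
  have h4 : (M.biUnion Sym2.toFinset).card = ∑ e ∈ M, e.toFinset.card := by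
    refine Finset.card_biUnion fun e he f hf hef => ?_
    rw [Function.onFun, Finset.disjoint_left]
    intro v hv hv'
    exact h3 e he f hf hef v ⟨Sym2.mem_toFinset.1 hv, Sym2.mem_toFinset.1 hv'⟩
  rw [Finset.sum_congr rfl fun e he =>
    Sym2.card_toFinset_of_not_isDiag e (G.not_isDiag_of_mem_edgeSet (h1 e he))] at h4
  have := Finset.card_le_univ (M.biUnion Sym2.toFinset)
  simp at h4
  omega

/-! ### Paths and cycles. -/

/-- The matching polynomials of the paths. -/
noncomputable def pathPoly : ℕ → ℕ[X]
  | 0 => 1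
  | 1 => 1
  | n + 2 => pathPoly (n + 1) + X * pathPoly n

/-- The matching polynomials of the cycles (of order at least `3`), extended backwards by their
recurrence. -/
noncomputable def cyclePoly : ℕ → ℕ[X]
  | 0 => 2
  | 1 => 1
  | n + 2 => cyclePoly (n + 1) + X * cyclePoly n

/-- For a genuine cycle this is deletion of one edge: avoiding it leaves a path on all vertices,
using it leaves a path on two fewer. -/
theorem cyclePoly_eq (n : ℕ) : cyclePoly (n + 2) = pathPoly (n + 2) + X * pathPoly n := by
  induction n using Nat.twoStepInduction with
  | zero => simp only [cyclePoly, pathPoly]; ring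
  | one => simp only [cyclePoly, pathPoly]; ring
  | more n ih1 ih2 =>
    rw [cyclePoly, ih2, ih1]
    simp only [pathPoly]
    ring

/-- The edges of a path on `{0, …, n - 1}`. -/
def pathEdges (n : ℕ) : Finset (Sym2 ℕ) := (Finset.range (n - 1)).image fun i => s(i, i + 1)

theorem mem_pathEdges {n a b : ℕ} :
    s(a, b) ∈ pathEdges n ↔ (a + 1 = b ∧ b < n) ∨ (b + 1 = a ∧ a < n) := by
  simp only [pathEdges, Finset.mem_image, Finset.mem_range, Sym2.eq_iff]
  constructor
  · rintro ⟨i, hi, ⟨rfl, rfl⟩ | ⟨rfl, rfl⟩⟩ <;> omega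
  · rintro (⟨rfl, h⟩ | ⟨rfl, h⟩)
    · exact ⟨a, by omega, by simp⟩
    · exact ⟨b, by omega, by simp⟩

theorem Sym2.apart_mk {α : Type*} {a b c d : α} :
    s(a, b).Apart s(c, d) ↔ a ≠ c ∧ a ≠ d ∧ b ≠ c ∧ b ≠ d := by
  simp only [Sym2.Apart, Sym2.mem_iff]
  constructor
  · intro h
    refine ⟨?_, ?_, ?_, ?_⟩ <;> rintro rfl
    · exact h a (by simp)
    · exact h a (by simp)
    · exact h b (by simp)
    · exact h b (by simp)
  · rintro ⟨h1, h2, h3, h4⟩ v ⟨rfl | rfl, rfl | rfl⟩ <;> contradiction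

theorem matchPoly_pathEdges (n : ℕ) : matchPoly (pathEdges n) = pathPoly n := by
  classical
  induction n using pathPoly.induct with
  | case1 => simpa [pathEdges, pathPoly] using matchPoly_empty
  | case2 => simpa [pathEdges, pathPoly] using matchPoly_empty
  | case3 n ih1 ih2 =>
    have h1 : pathEdges (n + 2) = insert s(n, n + 1) (pathEdges (n + 1)) := by
      simp [pathEdges, Finset.range_add_one]
    have h2 : (pathEdges (n + 1)).filter s(n, n + 1).Apart = pathEdges n := by
      ext e
      induction e with
      | _ a b =>
        simp only [Finset.mem_filter, mem_pathEdges, Sym2.apart_mk]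
        omega
    rw [h1, matchPoly_insert, h2, ih1, ih2, pathPoly]
    simp only [mem_pathEdges]
    omega

theorem graphPoly_pathGraph (n : ℕ) : graphPoly (SimpleGraph.pathGraph n) = pathPoly n := by
  rw [← matchPoly_pathEdges]
  refine graphPoly_eq_matchPoly _ Fin.val_injective _ fun a b => ?_
  rw [mem_pathEdges]
  simp only [SimpleGraph.pathGraph_adj]
  constructor
  · intro h
    exact ⟨⟨a, by omega⟩, ⟨b, by omega⟩, by simp only; omega, rfl, rfl⟩
  · rintro ⟨u, v, h, rfl, rfl⟩
    omega

theorem cycleGraph_adj_iff {n : ℕ} (hn : 2 ≤ n) {u v : Fin n} :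
    (SimpleGraph.cycleGraph n).Adj u v ↔ u.val + 1 = v.val ∨ v.val + 1 = u.val ∨
      (u.val = 0 ∧ v.val + 1 = n) ∨ (v.val = 0 ∧ u.val + 1 = n) := by
  have key : ∀ a b : Fin n, (a - b).val = 1 ↔ b.val + 1 = a.val ∨ (a.val = 0 ∧ b.val + 1 = n) := by
    intro a b
    have ha := a.isLt
    have hb := b.isLt
    rw [Fin.val_sub]
    rcases le_or_gt b.val a.val with h | h
    · rw [show n - b.val + a.val = (a.val - b.val) + n by omega, Nat.add_mod_right,
        Nat.mod_eq_of_lt (by omega)]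
      omega
    · rw [Nat.mod_eq_of_lt (by omega)]
      omega
  rw [SimpleGraph.cycleGraph_adj', key, key]
  tauto

theorem graphPoly_cycleGraph {n : ℕ} (hn : 3 ≤ n) :
    graphPoly (SimpleGraph.cycleGraph n) = cyclePoly n := by
  classical
  -- The closing edge `s(0, n - 1)` kills both end edges of the path, leaving the path on `1, …, n -
  -- 2`, a shifted `pathEdges (n - 2)`.
  have h1 : (pathEdges n).filter s(0, n - 1).Apart =
      (pathEdges (n - 2)).image (Sym2.map (· + 1)) := by
    ext e
    induction e with
    | _ a b =>
      simp only [Finset.mem_filter, mem_pathEdges, Sym2.apart_mk, Finset.mem_image, Sym2.exists,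
        Sym2.map_mk, Sym2.eq_iff]
      constructor
      · intro h
        exact ⟨a - 1, b - 1, by omega, by omega⟩
      · rintro ⟨x, y, h, ⟨rfl, rfl⟩ | ⟨rfl, rfl⟩⟩ <;> omega
  have h2 : s(0, n - 1) ∉ pathEdges n := by
    rw [mem_pathEdges]
    omega
  rw [← Nat.sub_add_cancel (show 2 ≤ n by omega), cyclePoly_eq,
    Nat.sub_add_cancel (show 2 ≤ n by omega), ← matchPoly_pathEdges, ← matchPoly_pathEdges,
    ← matchPoly_image (add_left_injective 1) (pathEdges (n - 2)), ← h1, ← matchPoly_insert h2]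
  refine graphPoly_eq_matchPoly _ Fin.val_injective _ fun a b => ?_
  simp only [cycleGraph_adj_iff (show 2 ≤ n by omega), Finset.mem_insert, mem_pathEdges,
    Sym2.eq_iff]
  constructor
  · intro h
    exact ⟨⟨a, by omega⟩, ⟨b, by omega⟩, by simp only; omega, rfl, rfl⟩
  · rintro ⟨u, v, h, rfl, rfl⟩
    omega

/-! ### Disjoint unions of paths and cycles. -/

namespace FinGraph

/-- The disjoint union of a list of graphs. -/
def listUnion : List FinGraph → FinGraph
  | [] => ⟨Empty, ⊥⟩
  | F :: L => F ∪ listUnion L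

/-- Makes `model` independent of the arbitrary order chosen by `Multiset.toList`. -/
theorem listUnion_perm {L L' : List FinGraph} (h : L.Perm L') :
    Nonempty ((listUnion L).graph ≃g (listUnion L').graph) := by
  induction h with
  | nil => exact ⟨SimpleGraph.Iso.refl⟩
  | cons F _ ih => exact ih.map fun e => SimpleGraph.Iso.sumCongr SimpleGraph.Iso.refl e
  | swap F H L =>
    exact ⟨SimpleGraph.Iso.sumAssoc.symm.trans ((SimpleGraph.Iso.sumCongr
      SimpleGraph.Iso.sumComm SimpleGraph.Iso.refl).trans SimpleGraph.Iso.sumAssoc)⟩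
  | trans _ _ ih1 ih2 => exact ⟨ih1.some.trans ih2.some⟩

/-- A graph on no vertices can be dropped from a disjoint union. -/
def emptySum {V W : Type*} [IsEmpty V] (G : SimpleGraph V) (H : SimpleGraph W) :
    G ⊕g H ≃g H where
  toEquiv := Equiv.emptySum V W
  map_rel_iff' := by
    rintro (u | u) (v | v)
    · exact isEmptyElim u
    · exact isEmptyElim u
    · exact isEmptyElim v
    · simp

theorem listUnion_append (L L' : List FinGraph) :
    Nonempty ((listUnion (L ++ L')).graph ≃g (listUnion L ∪ listUnion L').graph) := by
  induction L with
  | nil =>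
    have : IsEmpty (listUnion []).V := inferInstanceAs (IsEmpty Empty)
    exact ⟨(emptySum (listUnion []).graph (listUnion L').graph).symm⟩
  | cons F L ih =>
    exact ih.map fun e => (SimpleGraph.Iso.sumCongr SimpleGraph.Iso.refl e).trans
      SimpleGraph.Iso.sumAssoc.symm

/-- The disjoint union of the paths with lengths in `ps` and the cycles with lengths in `cs`. -/
noncomputable def model (ps cs : Multiset ℕ) : FinGraph :=
  listUnion (ps.toList.map P ++ cs.toList.map C)

/-- `G` is the disjoint union of paths of orders `ps` and cycles of orders `cs`. -/
def IsModel {V : Type*} (G : SimpleGraph V) (ps cs : Multiset ℕ) : Prop :=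
  Nonempty (G ≃g (model ps cs).graph)

theorem IsModel.congr {V W : Type*} {G : SimpleGraph V} {H : SimpleGraph W}
    {ps cs : Multiset ℕ} (h : IsModel H ps cs) (e : G ≃g H) : IsModel G ps cs :=
  h.map fun e' => e.trans e'

theorem IsModel.iso {V W : Type*} {G : SimpleGraph V} {H : SimpleGraph W}
    {ps cs : Multiset ℕ} (h : IsModel G ps cs) (h' : IsModel H ps cs) : Nonempty (G ≃g H) :=
  ⟨h.some.trans h'.some.symm⟩

theorem isModel_of_perm {L : List FinGraph} {ps cs : Multiset ℕ}
    (h : L.Perm (ps.toList.map P ++ cs.toList.map C)) : IsModel (listUnion L).graph ps cs :=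
  listUnion_perm h

theorem isModel_zero {V : Type*} [IsEmpty V] (G : SimpleGraph V) : IsModel G 0 0 := by
  have : IsEmpty (model 0 0).V := by
    simp only [model, Multiset.toList_zero, List.map_nil, List.append_nil]
    exact inferInstanceAs (IsEmpty Empty)
  exact ⟨⟨Equiv.equivOfIsEmpty _ _, fun {a} => isEmptyElim a⟩⟩

theorem toList_add_perm (s t : Multiset ℕ) :
    (s + t).toList.Perm (s.toList ++ t.toList) := by
  rw [← Multiset.coe_eq_coe, ← Multiset.coe_add]
  simp

theorem IsModel.sum {V W : Type*} {G : SimpleGraph V} {H : SimpleGraph W}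
    {ps cs ps' cs' : Multiset ℕ} (h : IsModel G ps cs) (h' : IsModel H ps' cs') :
    IsModel (G ⊕g H) (ps + ps') (cs + cs') := by
  obtain ⟨e⟩ := h
  obtain ⟨e'⟩ := h'
  obtain ⟨e1⟩ := listUnion_append (ps.toList.map P ++ cs.toList.map C)
    (ps'.toList.map P ++ cs'.toList.map C)
  refine (isModel_of_perm ?_).congr ((SimpleGraph.Iso.sumCongr e e').trans e1.symm)
  have h1 := ((toList_add_perm ps ps').map P).append ((toList_add_perm cs cs').map C)
  refine List.Perm.trans ?_ h1.symm
  simp only [List.map_append, List.append_assoc]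
  refine List.Perm.append_left _ ?_
  rw [← List.append_assoc, ← List.append_assoc]
  exact List.Perm.append_right _ List.perm_append_comm

theorem IsModel.union {F H : FinGraph} {ps cs ps' cs' : Multiset ℕ}
    (h : IsModel F.graph ps cs) (h' : IsModel H.graph ps' cs') :
    IsModel (F ∪ H).graph (ps + ps') (cs + cs') := h.sum h'

theorem isModel_path (a : ℕ) : IsModel (P a).graph {a} 0 := by
  have : IsModel (listUnion [P a]).graph {a} 0 := isModel_of_perm (by simp)
  exact this.congr
    (SimpleGraph.Iso.sumComm.trans (emptySum (⊥ : SimpleGraph Empty) (P a).graph)).symm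

theorem isModel_cycle (a : ℕ) : IsModel (C a).graph 0 {a} := by
  have : IsModel (listUnion [C a]).graph 0 {a} := isModel_of_perm (by simp)
  exact this.congr
    (SimpleGraph.Iso.sumComm.trans (emptySum (⊥ : SimpleGraph Empty) (C a).graph)).symm

theorem IsModel.smul {F : FinGraph} {ps cs : Multiset ℕ} (h : IsModel F.graph ps cs) (q : ℕ) :
    IsModel (q • F).graph (q • ps) (q • cs) := by
  induction q with
  | zero =>
    rw [zero_nsmul, zero_nsmul]
    exact isModel_zero (V := Empty) _
  | succ q ih =>
    rw [succ_nsmul, succ_nsmul]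
    exact ih.union h

end FinGraph

open FinGraph

/-! ### Degrees and polynomials of disjoint unions of paths and cycles. -/

/-- Membership in `Ω(n, k)` in terms of the sizes of the neighbour sets. -/
theorem inOmega_iff {V : Type*} [Fintype V] {G : SimpleGraph V} {n k : ℕ} :
    InOmega n k G ↔ Nat.card V = n ∧ {v | (G.neighborSet v).ncard = 1}.ncard = 2 * k ∧
      ∀ v, (G.neighborSet v).ncard = 1 ∨ (G.neighborSet v).ncard = 2 := by
  classical
  have h : ∀ v, G.degree v = (G.neighborSet v).ncard := fun v => by
    rw [← SimpleGraph.card_neighborFinset_eq_degree, ← Set.ncard_coe_finset,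
      SimpleGraph.coe_neighborFinset]
  rw [InOmega, Nat.card_eq_fintype_card, ← Set.ncard_coe_finset, Finset.coe_filter]
  simp only [Finset.mem_univ, true_and, ← h]

theorem neighborSet_inl {V W : Type*} (G : SimpleGraph V) (H : SimpleGraph W) (v : V) :
    (G ⊕g H).neighborSet (Sum.inl v) = Sum.inl '' G.neighborSet v := by
  ext (w | w) <;> simp

theorem neighborSet_inr {V W : Type*} (G : SimpleGraph V) (H : SimpleGraph W) (v : W) :
    (G ⊕g H).neighborSet (Sum.inr v) = Sum.inr '' H.neighborSet v := by
  ext (w | w) <;> simp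

theorem InOmega.sum {V W : Type*} [Fintype V] [Fintype W] {G : SimpleGraph V}
    {H : SimpleGraph W} {n k n' k' : ℕ} (hG : InOmega n k G) (hH : InOmega n' k' H) :
    InOmega (n + n') (k + k') (G ⊕g H) := by
  rw [inOmega_iff] at *
  obtain ⟨h1, h2, h3⟩ := hG
  obtain ⟨h1', h2', h3'⟩ := hH
  have hl : ∀ v, ((G ⊕g H).neighborSet (Sum.inl v)).ncard = (G.neighborSet v).ncard := fun v => by
    rw [neighborSet_inl, Set.ncard_image_of_injective _ Sum.inl_injective]
  have hr : ∀ v, ((G ⊕g H).neighborSet (Sum.inr v)).ncard = (H.neighborSet v).ncard := fun v => by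
    rw [neighborSet_inr, Set.ncard_image_of_injective _ Sum.inr_injective]
  refine ⟨by rw [Nat.card_sum, h1, h1'], ?_, ?_⟩
  · have : {v | ((G ⊕g H).neighborSet v).ncard = 1} =
        Sum.inl '' {v | (G.neighborSet v).ncard = 1} ∪
          Sum.inr '' {v | (H.neighborSet v).ncard = 1} := by
      ext (v | v) <;> simp [-Set.ncard_eq_one, hl, hr]
    rw [this, Set.ncard_union_eq, Set.ncard_image_of_injective _ Sum.inl_injective,
      Set.ncard_image_of_injective _ Sum.inr_injective, h2, h2', mul_add]
    rw [Set.disjoint_left]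
    rintro _ ⟨a, -, rfl⟩ ⟨b, -, hb⟩
    cases hb
  · rintro (v | v)
    · rw [hl]; exact h3 v
    · rw [hr]; exact h3' v

theorem InOmega.congr {V W : Type*} [Fintype V] [Fintype W] {G : SimpleGraph V}
    {H : SimpleGraph W} {n k : ℕ} (hG : InOmega n k G) (e : G ≃g H) : InOmega n k H := by
  rw [inOmega_iff] at *
  obtain ⟨h1, h2, h3⟩ := hG
  have he : ∀ v, (G.neighborSet v).ncard = (H.neighborSet (e v)).ncard := fun v => by
    rw [← Set.ncard_image_of_injective _ e.injective]
    congr 1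
    ext w
    simp only [Set.mem_image, SimpleGraph.mem_neighborSet]
    constructor
    · rintro ⟨u, hu, rfl⟩
      exact e.map_adj_iff.2 hu
    · intro hw
      exact ⟨e.symm w, by rw [← e.map_adj_iff]; simpa using hw, by simp⟩
  refine ⟨by rw [← Nat.card_congr e.toEquiv, h1], ?_, fun w => ?_⟩
  · rw [← h2, ← Set.ncard_image_of_injective _ e.injective]
    congr 1
    ext w
    simp only [Set.mem_image, Set.mem_ofPred_eq]
    constructor
    · intro hw
      exact ⟨e.symm w, by rw [he]; simpa using hw, by simp⟩
    · rintro ⟨u, hu, rfl⟩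
      rw [← he, hu]
  · have := h3 (e.symm w)
    rw [he] at this
    simpa using this

theorem inOmega_path {a : ℕ} (ha : 2 ≤ a) : InOmega a 1 (P a).graph := by
  rw [inOmega_iff]
  change Nat.card (Fin a) = a ∧
    {v : Fin a | ((SimpleGraph.pathGraph a).neighborSet v).ncard = 1}.ncard = 2 * 1 ∧ ∀ v : Fin a, ((SimpleGraph.pathGraph a).neighborSet v).ncard = 1 ∨
      ((SimpleGraph.pathGraph a).neighborSet v).ncard = 2
  have h : ∀ v : Fin a, ((SimpleGraph.pathGraph a).neighborSet v).ncard =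
      if v.val = 0 ∨ v.val + 1 = a then 1 else 2 := by
    intro v
    have hv := v.isLt
    split_ifs with h
    · rw [Set.ncard_eq_one]
      rcases h with h | h
      · refine ⟨⟨1, by omega⟩, ?_⟩
        ext w
        simp only [SimpleGraph.mem_neighborSet, SimpleGraph.pathGraph_adj, Set.mem_singleton_iff,
          Fin.ext_iff]
        omega
      · refine ⟨⟨a - 2, by omega⟩, ?_⟩
        ext w
        simp only [SimpleGraph.mem_neighborSet, SimpleGraph.pathGraph_adj, Set.mem_singleton_iff,
          Fin.ext_iff]
        omega
    · rw [Set.ncard_eq_two]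
      refine ⟨⟨v.val - 1, by omega⟩, ⟨v.val + 1, by omega⟩, ?_, ?_⟩
      · simp only [ne_eq, Fin.ext_iff]
        omega
      · ext w
        simp only [SimpleGraph.mem_neighborSet, SimpleGraph.pathGraph_adj, Set.mem_insert_iff,
          Set.mem_singleton_iff, Fin.ext_iff]
        omega
  refine ⟨by simp, ?_, fun v => ?_⟩
  · rw [mul_one, Set.ncard_eq_two]
    refine ⟨⟨0, by omega⟩, ⟨a - 1, by omega⟩, ?_, ?_⟩
    · simp only [ne_eq, Fin.ext_iff]
      omega
    · ext v
      have hv := v.isLt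
      simp only [Set.mem_ofPred_eq, h, Set.mem_insert_iff, Set.mem_singleton_iff, Fin.ext_iff]
      split_ifs <;> omega
  · rw [h]
    split_ifs <;> simp

theorem inOmega_cycle {a : ℕ} (ha : 3 ≤ a) : InOmega a 0 (FinGraph.C a).graph := by
  obtain ⟨a, rfl⟩ := Nat.exists_eq_add_of_le' ha
  have h : ∀ v : Fin (a + 3), (SimpleGraph.cycleGraph (a + 3)).degree v = 2 := fun v =>
    SimpleGraph.cycleGraph_degree_three_le
  have h' : ∀ v : Fin (a + 3), ((SimpleGraph.cycleGraph (a + 3)).neighborSet v).ncard = 2 :=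
    fun v => by
      rw [← h v, ← SimpleGraph.card_neighborFinset_eq_degree, ← Set.ncard_coe_finset,
        SimpleGraph.coe_neighborFinset]
  rw [inOmega_iff]
  refine ⟨Nat.card_fin _, ?_, fun v => Or.inr (h' v)⟩
  rw [mul_zero, Set.ncard_eq_zero (Set.toFinite _)]
  refine Set.eq_empty_of_forall_notMem fun v hv => ?_
  have h1 := h' v
  have h2 : ((SimpleGraph.cycleGraph (a + 3)).neighborSet v).ncard = 1 := hv
  omega

theorem inOmega_empty {V : Type*} [Fintype V] [IsEmpty V] (G : SimpleGraph V) :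
    InOmega 0 0 G := by
  rw [inOmega_iff]
  exact ⟨by simp, by simp [Set.eq_empty_of_isEmpty], fun v => isEmptyElim v⟩

theorem inOmega_listUnion (lp lc : List ℕ) (hp : ∀ a ∈ lp, 2 ≤ a) (hc : ∀ a ∈ lc, 3 ≤ a) :
    InOmega (lp.sum + lc.sum) lp.length (listUnion (lp.map P ++ lc.map FinGraph.C)).graph := by
  induction lp with
  | nil =>
    rw [List.map_nil, List.nil_append, List.sum_nil, zero_add, List.length_nil]
    induction lc with
    | nil => exact inOmega_empty (V := Empty) _
    | cons a L ih =>
      rw [List.sum_cons]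
      exact (inOmega_cycle (hc a (by simp))).sum (ih fun b hb => hc b (by simp [hb]))
  | cons a L ih =>
    rw [List.sum_cons, List.length_cons, add_assoc, add_comm L.length]
    exact (inOmega_path (hp a (by simp))).sum (ih fun b hb => hp b (by simp [hb]))

theorem inOmega_model {ps cs : Multiset ℕ} (hps : ∀ a ∈ ps, 2 ≤ a) (hcs : ∀ a ∈ cs, 3 ≤ a) :
    InOmega (ps.sum + cs.sum) ps.card (model ps cs).graph := by
  have := inOmega_listUnion ps.toList cs.toList (fun a ha => hps a (Multiset.mem_toList.1 ha))
    (fun a ha => hcs a (Multiset.mem_toList.1 ha))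
  rwa [Multiset.sum_toList, Multiset.sum_toList, Multiset.length_toList] at this

theorem FinGraph.IsModel.inOmega {V : Type*} [Fintype V] {G : SimpleGraph V}
    {ps cs : Multiset ℕ} (h : IsModel G ps cs) (hps : ∀ a ∈ ps, 2 ≤ a) (hcs : ∀ a ∈ cs, 3 ≤ a) :
    InOmega (ps.sum + cs.sum) ps.card G :=
  (inOmega_model hps hcs).congr h.some.symm

theorem graphPoly_listUnion (lp lc : List ℕ) (hc : ∀ a ∈ lc, 3 ≤ a) :
    graphPoly (listUnion (lp.map P ++ lc.map FinGraph.C)).graph =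
      (lp.map pathPoly).prod * (lc.map cyclePoly).prod := by
  induction lp with
  | nil =>
    rw [List.map_nil, List.nil_append, List.map_nil, List.prod_nil, one_mul]
    induction lc with
    | nil =>
      refine (graphPoly_eq_matchPoly (V := Empty) (α := Empty) _ Function.injective_id ∅ ?_).trans
        matchPoly_empty
      exact fun a => a.elim
    | cons a L ih =>
      rw [List.map_cons (f := cyclePoly), List.prod_cons, ← ih fun b hb => hc b (by simp [hb]),
        ← graphPoly_cycleGraph (hc a (by simp))]
      exact graphPoly_sum _ _
  | cons a L ih =>
    rw [List.map_cons (f := pathPoly), List.prod_cons, mul_assoc, ← ih, ← graphPoly_pathGraph]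
    exact graphPoly_sum _ _

theorem FinGraph.IsModel.graphPoly_eq {V : Type*} [Finite V] {G : SimpleGraph V}
    {ps cs : Multiset ℕ} (h : IsModel G ps cs) (hcs : ∀ a ∈ cs, 3 ≤ a) :
    graphPoly G = (ps.map pathPoly).prod * (cs.map cyclePoly).prod := by
  rw [graphPoly_congr h.some, model,
    graphPoly_listUnion _ _ fun a ha => hcs a (Multiset.mem_toList.1 ha),
    Multiset.prod_map_toList, Multiset.prod_map_toList]

/-! ### Decomposition of a graph with degrees 1 and 2. -/

/-- A graph is the disjoint union of its restrictions to a set closed under adjacency and to the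
complement of this set. -/
theorem nonempty_iso_induce_sum {V : Type*} (G : SimpleGraph V) (S : Set V)
    (hS : ∀ u ∈ S, ∀ v, G.Adj u v → v ∈ S) :
    Nonempty (G ≃g (G.induce S) ⊕g (G.induce Sᶜ)) := by
  classical
  refine ⟨SimpleGraph.Iso.symm ⟨Equiv.Set.sumCompl S, ?_⟩⟩
  rintro (u | u) (v | v)
  · simp
  · simpa using fun h => v.2 (hS u u.2 v h)
  · simpa using fun h => u.2 (hS v v.2 u h.symm)
  · simp

/-- The first `m` values of `f` are the successive vertices of a path in `G`. -/
def IsPathSeq {V : Type*} (G : SimpleGraph V) (m : ℕ) (f : ℕ → V) : Prop :=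
  (∀ i < m, ∀ j < m, f i = f j → i = j) ∧ ∀ i, i + 1 < m → G.Adj (f i) (f (i + 1))

/-- Injectivity bounds the length of a path sequence by the number of vertices, so a longest one
exists; its vertex set will be a component. -/
theorem exists_longest_pathSeq {V : Type*} [Finite V] [Nonempty V] (G : SimpleGraph V) :
    ∃ m f, IsPathSeq G m f ∧ 1 ≤ m ∧ ∀ f', ¬ IsPathSeq G (m + 1) f' := by
  have hne : {m | ∃ f, IsPathSeq G m f}.Nonempty :=
    ⟨1, fun _ => Classical.arbitrary V, fun i hi j hj _ => by omega, fun i hi => by omega⟩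
  have hb : BddAbove {m | ∃ f, IsPathSeq G m f} := by
    refine ⟨Nat.card V, ?_⟩
    rintro m ⟨f, hf, -⟩
    have := Nat.card_le_card_of_injective (fun i : Fin m => f i)
      fun i j hij => Fin.ext (hf i i.2 j j.2 hij)
    simpa using this
  obtain ⟨f, hf⟩ := Nat.sSup_mem hne hb
  refine ⟨_, f, hf, le_csSup hb ?_, fun f' hf' => ?_⟩
  · exact ⟨fun _ => Classical.arbitrary V, fun i hi j hj _ => by omega, fun i hi => by omega⟩
  · have := le_csSup hb ⟨f', hf'⟩
    omega

theorem eq_or_eq_of_ncard_le_two {α : Type*} [Finite α] {s : Set α} (hs : s.ncard ≤ 2)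
    {x y z : α} (hx : x ∈ s) (hy : y ∈ s) (hz : z ∈ s) (hxy : x ≠ y) : z = x ∨ z = y := by
  by_contra! h
  have : ({x, y, z} : Set α).ncard = 3 :=
    Set.ncard_eq_three.2 ⟨x, y, z, hxy, h.1.symm, h.2.symm, rfl⟩
  have h2 : ({x, y, z} : Set α) ⊆ s := by
    rintro w (rfl | rfl | rfl) <;> assumption
  have := Set.ncard_le_ncard h2
  omega

theorem IsPathSeq.inner_neighbor {V : Type*} [Finite V] {G : SimpleGraph V}
    (hG : ∀ v, (G.neighborSet v).ncard ≤ 2) {m : ℕ} {f : ℕ → V} (hf : IsPathSeq G m f) {i : ℕ}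
    (h0 : 0 < i) (h1 : i + 1 < m) {w : V} (hw : G.Adj (f i) w) :
    w = f (i - 1) ∨ w = f (i + 1) := by
  refine eq_or_eq_of_ncard_le_two (hG (f i)) ?_ (hf.2 i h1) hw ?_
  · have := hf.2 (i - 1) (by omega)
    rw [Nat.sub_add_cancel h0] at this
    exact this.symm
  · intro h
    have := hf.1 _ (by omega) _ (by omega) h
    omega

theorem IsPathSeq.append {V : Type*} {G : SimpleGraph V} {m : ℕ} {f : ℕ → V}
    (hf : IsPathSeq G m f) {w : V} (hw : G.Adj (f (m - 1)) w) (hn : ∀ j < m, w ≠ f j) :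
    IsPathSeq G (m + 1) (fun i => if i < m then f i else w) := by
  refine ⟨fun i hi j hj h => ?_, fun i hi => ?_⟩
  · by_cases h1 : i < m <;> by_cases h2 : j < m <;> simp only [h1, h2, if_true, if_false] at h
    · exact hf.1 i h1 j h2 h
    · exact absurd h.symm (hn i h1)
    · exact absurd h (hn j h2)
    · omega
  · by_cases h1 : i + 1 < m
    · simpa [h1, show i < m by omega] using hf.2 i h1
    · obtain rfl : i = m - 1 := by omega
      have h2 : m - 1 < m := by omega
      simpa [h1, h2] using hw

theorem IsPathSeq.prepend {V : Type*} {G : SimpleGraph V} {m : ℕ} {f : ℕ → V}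
    (hf : IsPathSeq G m f) {w : V} (hw : G.Adj (f 0) w) (hn : ∀ j < m, w ≠ f j) :
    IsPathSeq G (m + 1) (fun i => if i = 0 then w else f (i - 1)) := by
  refine ⟨fun i hi j hj h => ?_, fun i hi => ?_⟩
  · by_cases h1 : i = 0 <;> by_cases h2 : j = 0 <;> simp only [h1, h2, if_true, if_false] at h
    · omega
    · exact absurd h (hn _ (by omega))
    · exact absurd h.symm (hn _ (by omega))
    · have := hf.1 _ (by omega) _ (by omega) h
      omega
  · by_cases h1 : i = 0
    · subst h1
      simpa using hw.symm
    · have := hf.2 (i - 1) (by omega)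
      rw [Nat.sub_add_cancel (by omega)] at this
      simpa [h1] using this

/-- In a graph with degrees `1` and `2`, some component is a path or a cycle. -/
theorem exists_path_or_cycle_component {V : Type*} [Finite V] [Nonempty V] (G : SimpleGraph V)
    (hG : ∀ v, (G.neighborSet v).ncard = 1 ∨ (G.neighborSet v).ncard = 2) :
    ∃ (S : Set V) (m : ℕ), S.Nonempty ∧ (∀ u ∈ S, ∀ v, G.Adj u v → v ∈ S) ∧
      ((2 ≤ m ∧ Nonempty (G.induce S ≃g SimpleGraph.pathGraph m)) ∨
        (3 ≤ m ∧ Nonempty (G.induce S ≃g SimpleGraph.cycleGraph m))) := by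
  have hG2 : ∀ v, (G.neighborSet v).ncard ≤ 2 := fun v => by rcases hG v with h | h <;> omega
  obtain ⟨m, f, hf, hm1, hmax⟩ := exists_longest_pathSeq G
  -- A new neighbour of an end would lengthen the path, and an inner vertex already has its two
  -- neighbours on the path.
  have hclosed : ∀ i < m, ∀ w, G.Adj (f i) w → ∃ j < m, w = f j := by
    intro i hi w hw
    by_contra! hn
    by_cases h0 : i = 0
    · subst h0
      exact hmax _ (hf.prepend hw hn)
    by_cases h1 : i + 1 < m
    · rcases hf.inner_neighbor hG2 (by omega) h1 hw with h | h
      · exact hn _ (by omega) h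
      · exact hn _ h1 h
    · obtain rfl : i = m - 1 := by omega
      exact hmax _ (hf.append hw hn)
  have hm : 2 ≤ m := by
    by_contra hlt
    obtain ⟨w, hw⟩ : (G.neighborSet (f 0)).Nonempty := by
      rw [Set.nonempty_iff_ne_empty]
      intro h
      have := hG (f 0)
      simp [h] at this
    obtain ⟨j, hj, rfl⟩ := hclosed 0 (by omega) w hw
    obtain rfl : j = 0 := by omega
    exact G.irrefl hw
  -- By the degree bound the only possible further edge joins the two ends.
  have hadj : ∀ i < m, ∀ j < m, G.Adj (f i) (f j) ↔ (i + 1 = j ∨ j + 1 = i ∨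
      (i = 0 ∧ j + 1 = m ∧ G.Adj (f 0) (f (m - 1))) ∨
      (j = 0 ∧ i + 1 = m ∧ G.Adj (f 0) (f (m - 1)))) := by
    intro i hi j hj
    constructor
    · intro h
      have hij : i ≠ j := by
        rintro rfl
        exact G.irrefl h
      by_cases h1 : 0 < i ∧ i + 1 < m
      · rcases hf.inner_neighbor hG2 h1.1 h1.2 h with h2 | h2
        · have := hf.1 _ hj _ (by omega) h2
          omega
        · have := hf.1 _ hj _ (by omega) h2
          omega
      · by_cases h3 : i = 0
        · by_cases h4 : j + 1 = m
          · obtain rfl : j = m - 1 := by omega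
            subst h3
            exact Or.inr (Or.inr (Or.inl ⟨rfl, h4, h⟩))
          · rcases hf.inner_neighbor hG2 (show 0 < j by omega) (by omega) h.symm with h2 | h2
            · have := hf.1 _ hi _ (by omega) h2
              omega
            · have := hf.1 _ hi _ (by omega) h2
              omega
        · by_cases h4 : j = 0
          · obtain rfl : i = m - 1 := by omega
            subst h4
            exact Or.inr (Or.inr (Or.inr ⟨rfl, by omega, h.symm⟩))
          · rcases hf.inner_neighbor hG2 (show 0 < j by omega) (by omega) h.symm with h2 | h2
            · have := hf.1 _ hi _ (by omega) h2
              omega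
            · have := hf.1 _ hi _ (by omega) h2
              omega
    · rintro (rfl | rfl | ⟨rfl, h1, h2⟩ | ⟨rfl, h1, h2⟩)
      · exact hf.2 i hj
      · exact (hf.2 j hi).symm
      · obtain rfl : j = m - 1 := by omega
        exact h2
      · obtain rfl : i = m - 1 := by omega
        exact h2.symm
  set S : Set V := {v | ∃ i < m, v = f i} with hS
  let g : Fin m → S := fun i => ⟨f i, i, i.2, rfl⟩
  have hg : Function.Bijective g := by
    constructor
    · intro i j hij
      exact Fin.ext (hf.1 i i.2 j j.2 (congrArg Subtype.val hij))
    · rintro ⟨v, i, hi, rfl⟩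
      exact ⟨⟨i, hi⟩, rfl⟩
  refine ⟨S, m, ⟨f 0, 0, by omega, rfl⟩, ?_, ?_⟩
  · rintro u ⟨i, hi, rfl⟩ v hv
    exact hclosed i hi v hv
  · by_cases hA : 3 ≤ m ∧ G.Adj (f 0) (f (m - 1))
    · refine Or.inr ⟨hA.1, ⟨SimpleGraph.Iso.symm ⟨Equiv.ofBijective g hg, ?_⟩⟩⟩
      intro i j
      rw [cycleGraph_adj_iff hm]
      refine (hadj i i.2 j j.2).trans ?_
      simp only [hA.2, and_true]
    · refine Or.inl ⟨hm, ⟨SimpleGraph.Iso.symm ⟨Equiv.ofBijective g hg, ?_⟩⟩⟩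
      intro i j
      rw [SimpleGraph.pathGraph_adj]
      refine (hadj i i.2 j j.2).trans ?_
      by_cases h : G.Adj (f 0) (f (m - 1))
      -- With two vertices the edge joining the ends is the path edge itself, so the component is
      -- still a path.
      · have : m = 2 := by
          by_contra h'
          exact hA ⟨by omega, h⟩
        simp only [h, and_true]
        omega
      · simp only [h, and_false, or_false]

/-- Induction on the number of vertices: removing a path or cycle component does not alter the
degrees of the remaining vertices. -/
theorem exists_isModel {V : Type*} [Finite V] (G : SimpleGraph V)
    (hG : ∀ v, (G.neighborSet v).ncard = 1 ∨ (G.neighborSet v).ncard = 2) :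
    ∃ ps cs : Multiset ℕ, (∀ a ∈ ps, 2 ≤ a) ∧ (∀ a ∈ cs, 3 ≤ a) ∧ IsModel G ps cs := by
  induction hN : Nat.card V using Nat.strong_induction_on generalizing V with
  | _ N ih =>
    rcases isEmpty_or_nonempty V with hV | hV
    · exact ⟨0, 0, by simp, by simp, isModel_zero G⟩
    obtain ⟨S, m, ⟨s, hs⟩, hS, h⟩ := exists_path_or_cycle_component G hG
    have hdeg : ∀ v : (Sᶜ : Set V),
        ((G.induce Sᶜ).neighborSet v).ncard = (G.neighborSet v).ncard := by
      intro v
      rw [← Set.ncard_image_of_injective _ Subtype.val_injective]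
      congr 1
      ext w
      simp only [Set.mem_image, SimpleGraph.mem_neighborSet, SimpleGraph.comap_adj,
        Function.Embedding.subtype_apply]
      constructor
      · rintro ⟨u, hu, rfl⟩
        exact hu
      · intro hw
        exact ⟨⟨w, fun hwS => v.2 (hS w hwS v hw.symm)⟩, hw, rfl⟩
    have hlt : Nat.card (Sᶜ : Set V) < N := by
      rw [← hN]
      exact Finite.card_subtype_lt (p := fun v => v ∈ Sᶜ) (x := s) (fun h => h hs)
    obtain ⟨ps, cs, hps, hcs, hmod⟩ := ih _ hlt (G.induce Sᶜ)
      (fun v => by rw [hdeg]; exact hG v) rfl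
    obtain ⟨e⟩ := nonempty_iso_induce_sum G S hS
    rcases h with ⟨hm, ⟨e'⟩⟩ | ⟨hm, ⟨e'⟩⟩
    · refine ⟨{m} + ps, 0 + cs, ?_, by simpa using hcs,
        (((isModel_path m).congr e').sum hmod).congr e⟩
      simpa using ⟨hm, hps⟩
    · refine ⟨0 + ps, {m} + cs, by simpa using hps, ?_,
        (((isModel_cycle m).congr e').sum hmod).congr e⟩
      simpa using ⟨hm, hcs⟩

/-- The members of `Ω(n, k)` are the disjoint unions of `k` paths and some cycles. -/
theorem InOmega.exists_isModel {V : Type*} [Fintype V] {G : SimpleGraph V} {n k : ℕ}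
    (hG : InOmega n k G) : ∃ ps cs : Multiset ℕ, (∀ a ∈ ps, 2 ≤ a) ∧ (∀ a ∈ cs, 3 ≤ a) ∧
      ps.card = k ∧ ps.sum + cs.sum = n ∧ IsModel G ps cs := by
  obtain ⟨ps, cs, hps, hcs, h⟩ := _root_.exists_isModel G (inOmega_iff.1 hG).2.2
  -- Counting degree-1 vertices and all vertices both in the model and in `G` gives the number of
  -- paths and the total order.
  have h1 := inOmega_iff.1 (h.inOmega hps hcs)
  have h2 := inOmega_iff.1 hG
  refine ⟨ps, cs, hps, hcs, ?_, ?_, h⟩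
  · have := h1.2.1.symm.trans h2.2.1
    omega
  · exact h1.1.symm.trans h2.1

/-! ### The coefficientwise order on polynomials over `ℕ`. -/

/-- The coefficientwise order on `ℕ[X]`, in its strict form. -/
def PolyLT (f g : ℕ[X]) : Prop := ∃ h ≠ 0, g = f + h

/-- The value at 1 is the sum of the natural coefficients, so nothing cancels. It serves as the
measure for termination and as a test for nonzero remainders. -/
theorem eval_one_eq_zero_iff {h : ℕ[X]} : h.eval 1 = 0 ↔ h = 0 := by
  constructor
  · intro H
    rw [eval_eq_sum, Polynomial.sum] at H
    simp only [one_pow, mul_one] at H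
    rw [Finset.sum_eq_zero_iff] at H
    ext n
    by_contra hn
    exact hn (H n (mem_support_iff.2 hn))
  · rintro rfl
    simp

theorem PolyLT.eval_lt {f g : ℕ[X]} (h : PolyLT f g) : f.eval 1 < g.eval 1 := by
  obtain ⟨r, hr, rfl⟩ := h
  rw [eval_add]
  have := mt eval_one_eq_zero_iff.1 hr
  omega

theorem PolyLT.trans {f g h : ℕ[X]} (hfg : PolyLT f g) (hgh : PolyLT g h) : PolyLT f h := by
  have hlt := hfg.eval_lt.trans hgh.eval_lt
  obtain ⟨a, -, rfl⟩ := hfg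
  obtain ⟨b, -, rfl⟩ := hgh
  refine ⟨a + b, fun h0 => ?_, add_assoc _ _ _⟩
  rw [add_assoc, h0, add_zero] at hlt
  exact lt_irrefl _ hlt

theorem PolyLT.mul_right {f g : ℕ[X]} (h : PolyLT f g) {r : ℕ[X]} (hr : r ≠ 0) :
    PolyLT (f * r) (g * r) := by
  obtain ⟨d, hd, rfl⟩ := h
  exact ⟨d * r, mul_ne_zero hd hr, add_mul _ _ _⟩

theorem pathPoly_ne_zero (n : ℕ) : pathPoly n ≠ 0 := by
  induction n using pathPoly.induct with
  | case1 => simp [pathPoly]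
  | case2 => simp [pathPoly]
  | case3 n ih1 ih2 =>
    rw [ne_eq, ← eval_one_eq_zero_iff] at *
    simp only [pathPoly, eval_add, eval_mul, eval_X]
    omega

theorem cyclePoly_ne_zero (n : ℕ) : cyclePoly n ≠ 0 := by
  induction n using cyclePoly.induct with
  | case1 => simp [cyclePoly]
  | case2 => simp [cyclePoly]
  | case3 n ih1 ih2 =>
    rw [ne_eq, ← eval_one_eq_zero_iff] at *
    simp only [cyclePoly, eval_add, eval_mul, eval_X]
    omega

/-- Combinatorially, matchings are sorted by whether they use the edge between the first `a + 1` and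
the last `b + 1` vertices. -/
theorem pathPoly_add (a b : ℕ) :
    pathPoly (a + b + 2) = pathPoly (a + 1) * pathPoly (b + 1) + X * (pathPoly a * pathPoly b) := by
  induction a using Nat.twoStepInduction with
  | zero => simp only [zero_add, pathPoly]; ring
  | one => rw [show 1 + b + 2 = b + 3 by omega]; simp only [pathPoly]; ring
  | more a ih1 ih2 =>
    rw [show a + 2 + b + 2 = a + b + 2 + 2 by omega, pathPoly,
      show a + b + 2 + 1 = a + 1 + b + 2 by omega, ih1, ih2]
    simp only [pathPoly]
    ring

/-! ### Exchanging some of the components. -/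

/-- The generating matching polynomial of a disjoint union of paths and cycles. -/
noncomputable def modelPoly (ps cs : Multiset ℕ) : ℕ[X] :=
  (ps.map pathPoly).prod * (cs.map cyclePoly).prod

theorem modelPoly_add (ps ps' cs cs' : Multiset ℕ) :
    modelPoly (ps + ps') (cs + cs') = modelPoly ps cs * modelPoly ps' cs' := by
  simp only [modelPoly, Multiset.map_add, Multiset.prod_add]
  ring

theorem modelPoly_ne_zero (ps cs : Multiset ℕ) : modelPoly ps cs ≠ 0 := by
  refine mul_ne_zero ?_ ?_
  · simpa [Multiset.prod_eq_zero_iff] using fun a _ => pathPoly_ne_zero a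
  · simpa [Multiset.prod_eq_zero_iff] using fun a _ => cyclePoly_ne_zero a

/-- The orders of the paths and cycles of a member of `Ω(n, k)`. -/
structure IsType (n k : ℕ) (ps cs : Multiset ℕ) : Prop where
  two_le : ∀ a ∈ ps, 2 ≤ a
  three_le : ∀ a ∈ cs, 3 ≤ a
  card_eq : ps.card = k
  sum_eq : ps.sum + cs.sum = n

theorem IsType.replace {n k : ℕ} {A A' B B' ps cs : Multiset ℕ} (h : IsType n k (A + ps) (B + cs))
    (hA : ∀ a ∈ A', 2 ≤ a) (hB : ∀ a ∈ B', 3 ≤ a) (hc : A'.card = A.card)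
    (hs : A'.sum + B'.sum = A.sum + B.sum) : IsType n k (A' + ps) (B' + cs) := by
  obtain ⟨h1, h2, h3, h4⟩ := h
  simp only [Multiset.mem_add, Multiset.card_add, Multiset.sum_add] at *
  refine ⟨?_, ?_, by simp only [Multiset.card_add]; omega, by
    simp only [Multiset.sum_add]; omega⟩
  · intro a ha
    exact (Multiset.mem_add.1 ha).elim (hA a) fun h => h1 a (Or.inr h)
  · intro a ha
    exact (Multiset.mem_add.1 ha).elim (hB a) fun h => h2 a (Or.inr h)

/-- Some member of `Ω(n, k)` has a smaller polynomial. -/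
def CanLower (n k : ℕ) (ps cs : Multiset ℕ) : Prop :=
  ∃ ps' cs', IsType n k ps' cs' ∧ PolyLT (modelPoly ps' cs') (modelPoly ps cs)

/-- Some member of `Ω(n, k)` has a larger polynomial. -/
def CanRaise (n k : ℕ) (ps cs : Multiset ℕ) : Prop :=
  ∃ ps' cs', IsType n k ps' cs' ∧ PolyLT (modelPoly ps cs) (modelPoly ps' cs')

/-- The untouched part `ps`, `cs` contributes a common nonzero factor, so a strict comparison of the
exchanged parts is enough. -/
theorem IsType.canLower {n k : ℕ} {qs ds : Multiset ℕ} (h : IsType n k qs ds)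
    (A' B' : Multiset ℕ) {A B ps cs : Multiset ℕ} (hp : qs = A + ps) (hc : ds = B + cs)
    (hlt : PolyLT (modelPoly A' B') (modelPoly A B))
    (hA : ∀ a ∈ A', 2 ≤ a) (hB : ∀ a ∈ B', 3 ≤ a) (hcard : A'.card = A.card)
    (hs : A'.sum + B'.sum = A.sum + B.sum) : CanLower n k qs ds := by
  subst hp hc
  refine ⟨A' + ps, B' + cs, h.replace hA hB hcard hs, ?_⟩
  rw [modelPoly_add, modelPoly_add]
  exact hlt.mul_right (modelPoly_ne_zero _ _)

theorem IsType.canRaise {n k : ℕ} {qs ds : Multiset ℕ} (h : IsType n k qs ds)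
    (A' B' : Multiset ℕ) {A B ps cs : Multiset ℕ} (hp : qs = A + ps) (hc : ds = B + cs)
    (hlt : PolyLT (modelPoly A B) (modelPoly A' B'))
    (hA : ∀ a ∈ A', 2 ≤ a) (hB : ∀ a ∈ B', 3 ≤ a) (hcard : A'.card = A.card)
    (hs : A'.sum + B'.sum = A.sum + B.sum) : CanRaise n k qs ds := by
  subst hp hc
  refine ⟨A' + ps, B' + cs, h.replace hA hB hcard hs, ?_⟩
  rw [modelPoly_add, modelPoly_add]
  exact hlt.mul_right (modelPoly_ne_zero _ _)

/-! ### The local inequalities. -/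

theorem X_pow_mul_pathPoly_ne_zero (r n : ℕ) : (X : ℕ[X]) ^ r * pathPoly n ≠ 0 :=
  mul_ne_zero (pow_ne_zero _ X_ne_zero) (pathPoly_ne_zero n)

theorem X_pow_mul_cyclePoly_ne_zero (r n : ℕ) : (X : ℕ[X]) ^ r * cyclePoly n ≠ 0 :=
  mul_ne_zero (pow_ne_zero _ X_ne_zero) (cyclePoly_ne_zero n)

/-- Used both ways: for the maximum it reduces two paths to one longer path and an edge, and for the
minimum, read backwards with `a = 0`, it removes an edge standing beside a long path. -/
theorem path_path_lt (a b : ℕ) : PolyLT (modelPoly ({a + 3} + {b + 3}) 0)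
    (modelPoly ({2} + {a + b + 4}) 0) := by
  refine ⟨X ^ 3 * pathPoly a * pathPoly b,
    mul_ne_zero (X_pow_mul_pathPoly_ne_zero _ _) (pathPoly_ne_zero _), ?_⟩
  have := pathPoly_add (a + 1) (b + 1)
  rw [show a + 1 + (b + 1) + 2 = a + b + 4 by omega] at this
  simp [modelPoly, this]
  simp only [pathPoly]
  ring

theorem path_lt_path_cycle (a : ℕ) :
    PolyLT (modelPoly {a + 6} 0) (modelPoly {2} {a + 4}) := by
  refine ⟨X ^ 3 * pathPoly a, X_pow_mul_pathPoly_ne_zero _ _, ?_⟩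
  simp [modelPoly, cyclePoly_eq]
  simp only [pathPoly]
  ring

/-- If `α`, `β` are the roots of `t² = t + X`, then `cyclePoly n = αⁿ + βⁿ` and `αβ = -X`. Hence for
`c ≤ d` the product for `c` and `d` exceeds the polynomial for `c + d` by `(-X)^c * cyclePoly (d -
c)`, which is positive for `c = 4` and negative for `c = 3`. -/
theorem cycle_lt_cycle_cycle (b : ℕ) :
    PolyLT (modelPoly 0 {b + 8}) (modelPoly 0 ({4} + {b + 4})) := by
  refine ⟨X ^ 4 * cyclePoly b, X_pow_mul_cyclePoly_ne_zero _ _, ?_⟩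
  simp [modelPoly]
  simp only [cyclePoly]
  ring

theorem path_three_cycle_lt (m : ℕ) :
    PolyLT (modelPoly {3} {m + 3}) (modelPoly {2} {m + 4}) := by
  refine ⟨X ^ 3 * cyclePoly m, X_pow_mul_cyclePoly_ne_zero _ _, ?_⟩
  simp [modelPoly]
  simp only [cyclePoly, pathPoly]
  ring

theorem path_four_cycle_lt (m : ℕ) :
    PolyLT (modelPoly {4} {m + 3}) (modelPoly {2} {m + 5}) := by
  refine ⟨X ^ 3 * cyclePoly m, X_pow_mul_cyclePoly_ne_zero _ _, ?_⟩
  simp [modelPoly]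
  simp only [cyclePoly, pathPoly]
  ring


theorem cycle_three_cycle_lt (b : ℕ) :
    PolyLT (modelPoly 0 ({3} + {b + 3})) (modelPoly 0 {b + 6}) := by
  refine ⟨X ^ 3 * cyclePoly b, X_pow_mul_cyclePoly_ne_zero _ _, ?_⟩
  simp [modelPoly]
  simp only [cyclePoly]
  ring

theorem path_three_cycle_lt_path (a : ℕ) :
    PolyLT (modelPoly {a + 3} {3}) (modelPoly {a + 6} 0) := by
  refine ⟨X ^ 3 * pathPoly a, X_pow_mul_pathPoly_ne_zero _ _, ?_⟩
  simp [modelPoly]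
  simp only [cyclePoly, pathPoly]
  ring

theorem path_three_path_lt (a b : ℕ) :
    PolyLT (modelPoly ({3} + {a + b + 5}) 0) (modelPoly ({a + 4} + {b + 4}) 0) := by
  refine ⟨X ^ 4 * pathPoly a * pathPoly b,
    mul_ne_zero (X_pow_mul_pathPoly_ne_zero _ _) (pathPoly_ne_zero _), ?_⟩
  have := pathPoly_add (a + 2) (b + 1)
  rw [show a + 2 + (b + 1) + 2 = a + b + 5 by omega] at this
  simp [modelPoly, this]
  simp only [pathPoly]
  ring

/-- Only these `a` are needed, since paths with six or more vertices are split beforehand; the four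
remainders are then explicit. -/
theorem path_three_cycle_lt_path_cycle_four {a : ℕ} (h2 : 2 ≤ a) (h5 : a ≤ 5) :
    PolyLT (modelPoly {a + 1} {3}) (modelPoly {a} {4}) := by
  have key : ∃ h : ℕ[X], h.eval 1 ≠ 0 ∧ modelPoly {a} {4} = modelPoly {a + 1} {3} + h := by
    simp only [modelPoly, Multiset.map_singleton, Multiset.prod_singleton]
    interval_cases a
    · exact ⟨2 * X ^ 3, by simp, by simp only [pathPoly, cyclePoly]; ring⟩
    · exact ⟨X ^ 3, by simp, by simp only [pathPoly, cyclePoly]; ring⟩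
    · exact ⟨X ^ 3 + 2 * X ^ 4, by simp, by simp only [pathPoly, cyclePoly]; ring⟩
    · exact ⟨X ^ 3 + 3 * X ^ 4, by simp, by simp only [pathPoly, cyclePoly]; ring⟩
  obtain ⟨h, h1, h2⟩ := key
  exact ⟨h, mt eval_one_eq_zero_iff.2 h1, h2⟩

theorem path_three_cycle_lt_path_cycle_five {a : ℕ} (h2 : 2 ≤ a) (h5 : a ≤ 5) :
    PolyLT (modelPoly {a + 2} {3}) (modelPoly {a} {5}) := by
  have key : ∃ h : ℕ[X], h.eval 1 ≠ 0 ∧ modelPoly {a} {5} = modelPoly {a + 2} {3} + h := by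
    simp only [modelPoly, Multiset.map_singleton, Multiset.prod_singleton]
    interval_cases a
    · exact ⟨2 * X ^ 3, by simp, by simp only [pathPoly, cyclePoly]; ring⟩
    · exact ⟨X ^ 3, by simp, by simp only [pathPoly, cyclePoly]; ring⟩
    · exact ⟨X ^ 3 + 2 * X ^ 4, by simp, by simp only [pathPoly, cyclePoly]; ring⟩
    · exact ⟨X ^ 3 + 3 * X ^ 4, by simp, by simp only [pathPoly, cyclePoly]; ring⟩
  obtain ⟨h, h1, h2⟩ := key
  exact ⟨h, mt eval_one_eq_zero_iff.2 h1, h2⟩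

theorem path_path_lt_path_path_cycle_three :
    PolyLT (modelPoly ({3} + {4}) 0) (modelPoly ({2} + {2}) {3}) := by
  refine ⟨X ^ 3, pow_ne_zero _ X_ne_zero, ?_⟩
  simp [modelPoly]
  simp only [pathPoly, cyclePoly]
  ring

/-- Two short cycles, neither of order `4` or of orders `3` and `4`, are not optimal. -/
theorem exists_cycle_cycle_lt {c d : ℕ} (hc : 3 ≤ c) (hcd : c ≤ d) (hd : d ≤ 7)
    (h : (c ≠ 4 ∧ d ≠ 4) ∨ (c = 3 ∧ d = 4)) :
    ∃ B : Multiset ℕ, (∀ b ∈ B, 3 ≤ b) ∧ B.sum = c + d ∧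
      PolyLT (modelPoly 0 ({c} + {d})) (modelPoly 0 B) := by
  -- With fewer than eight vertices the two cycles are merged into one; otherwise a `C 4` is split
  -- off from their total order.
  by_cases h8 : c + d < 8
  · refine ⟨{c + d}, by simp; omega, by simp, ?_⟩
    obtain ⟨rfl, rfl⟩ | ⟨rfl, rfl⟩ : (c = 3 ∧ d = 3) ∨ (c = 3 ∧ d = 4) := by omega
    · refine ⟨2 * X ^ 3, mul_ne_zero two_ne_zero (pow_ne_zero _ X_ne_zero), ?_⟩
      simp [modelPoly]
      simp only [cyclePoly]
      ring
    · refine ⟨X ^ 3, pow_ne_zero _ X_ne_zero, ?_⟩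
      simp [modelPoly]
      simp only [cyclePoly]
      ring
  · refine ⟨{4} + {c + d - 4}, by simp; omega, by simp; omega, ?_⟩
    have key : ∃ h : ℕ[X], h.eval 1 ≠ 0 ∧
        cyclePoly 4 * cyclePoly (c + d - 4) = cyclePoly c * cyclePoly d + h := by
      have h3 : (c = 3 ∧ d = 5) ∨ (c = 3 ∧ d = 6) ∨ (c = 3 ∧ d = 7) ∨ (c = 5 ∧ d = 5) ∨
        (c = 5 ∧ d = 6) ∨ (c = 5 ∧ d = 7) ∨ (c = 6 ∧ d = 6) ∨ (c = 6 ∧ d = 7) ∨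
        (c = 7 ∧ d = 7) := by omega
      rcases h3 with ⟨rfl, rfl⟩ | ⟨rfl, rfl⟩ | ⟨rfl, rfl⟩ | ⟨rfl, rfl⟩ | ⟨rfl, rfl⟩ |
        ⟨rfl, rfl⟩ | ⟨rfl, rfl⟩ | ⟨rfl, rfl⟩ | ⟨rfl, rfl⟩
      · exact ⟨X ^ 3 + 4 * X ^ 4, by simp, by simp only [cyclePoly]; ring⟩
      · exact ⟨X ^ 3 + 4 * X ^ 4, by simp, by simp only [cyclePoly]; ring⟩
      · exact ⟨X ^ 3 + 5 * X ^ 4 + 4 * X ^ 5, by simp, by simp only [cyclePoly]; ring⟩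
      · exact ⟨X ^ 4 + 4 * X ^ 5, by simp, by simp only [cyclePoly]; ring⟩
      · exact ⟨X ^ 4 + 4 * X ^ 5, by simp, by simp only [cyclePoly]; ring⟩
      · exact ⟨X ^ 4 + 5 * X ^ 5 + 4 * X ^ 6, by simp, by simp only [cyclePoly]; ring⟩
      · exact ⟨X ^ 4 + 4 * X ^ 5, by simp, by simp only [cyclePoly]; ring⟩
      · exact ⟨X ^ 4 + 5 * X ^ 5 + 4 * X ^ 6, by simp, by simp only [cyclePoly]; ring⟩
      · exact ⟨X ^ 4 + 6 * X ^ 5 + 9 * X ^ 6 + 4 * X ^ 7, by simp, by simp only [cyclePoly]; ring⟩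
    obtain ⟨r, h1, h2⟩ := key
    exact ⟨r, mt eval_one_eq_zero_iff.2 h1, by simpa [modelPoly] using h2⟩

/-- This coincidence is the reason why two extremal graphs occur in some cases. -/
theorem pathPoly_five : pathPoly 5 = pathPoly 2 * cyclePoly 3 := by
  simp only [pathPoly, cyclePoly]
  ring

theorem exists_singleton_add_of_mem {s : Multiset ℕ} {a : ℕ} (h : a ∈ s) : ∃ t, s = {a} + t :=
  (Multiset.exists_cons_of_mem h).imp fun t ht => by rw [ht, Multiset.singleton_add]

theorem exists_replicate_add_replicate {s : Multiset ℕ} {u v : ℕ} (h : ∀ x ∈ s, x = u ∨ x = v) :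
    ∃ a b, s = Multiset.replicate a u + Multiset.replicate b v := by
  induction s using Multiset.induction with
  | empty => exact ⟨0, 0, by simp⟩
  | cons x s ih =>
    obtain ⟨a, b, rfl⟩ := ih fun y hy => h y (Multiset.mem_cons_of_mem hy)
    rcases h x (Multiset.mem_cons_self _ _) with rfl | rfl
    · exact ⟨a + 1, b, by rw [Multiset.replicate_succ, Multiset.cons_add]⟩
    · exact ⟨a, b + 1, by rw [Multiset.replicate_succ, Multiset.add_cons]⟩

theorem eq_replicate_or_exists_add {s : Multiset ℕ} (u : ℕ) :
    (∃ q, s = Multiset.replicate q u) ∨ ∃ a t, a ≠ u ∧ s = {a} + t := by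
  by_cases h : ∀ a ∈ s, a = u
  · exact Or.inl ⟨_, Multiset.eq_replicate_card.2 h⟩
  · push Not at h
    obtain ⟨a, ha, hau⟩ := h
    obtain ⟨t, ht⟩ := exists_singleton_add_of_mem ha
    exact Or.inr ⟨a, t, hau, ht⟩

/-! ### Graphs that no exchange lowers. -/

namespace FinGraph

theorem IsModel.cast {V : Type*} {G : SimpleGraph V} {ps cs ps' cs' : Multiset ℕ}
    (h : IsModel G ps cs) (hp : ps = ps') (hc : cs = cs') : IsModel G ps' cs' := by
  rwa [← hp, ← hc]

theorem isModel_smul_path (q a : ℕ) : IsModel (q • P a).graph (Multiset.replicate q a) 0 :=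
  ((isModel_path a).smul q).cast (Multiset.nsmul_singleton _ _) (smul_zero _)

theorem isModel_smul_cycle (q a : ℕ) : IsModel (q • C a).graph 0 (Multiset.replicate q a) :=
  ((isModel_cycle a).smul q).cast (smul_zero _) (Multiset.nsmul_singleton _ _)

theorem minGraphs_terminal_of_paths {a b : ℕ} :
    ∃ F ∈ minGraphs a (a + b), IsModel F.graph
      (Multiset.replicate a 3 + Multiset.replicate b 2) 0 := by
  refine ⟨a • P 3 ∪ b • P 2, ?_, ?_⟩
  · rw [minGraphs, if_pos (by omega), Nat.add_sub_cancel_left]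
    rfl
  · exact ((isModel_smul_path a 3).union (isModel_smul_path b 2)).cast rfl rfl

/-- Without triangles the parameter `l = k` would fall under the case `l ≤ k`, hence `1 ≤ q`. -/
theorem minGraphs_terminal_zero {k q : ℕ} (hq : 1 ≤ q) :
    ∃ F ∈ minGraphs (k + 3 * q) k, IsModel F.graph
      (Multiset.replicate k 3) (Multiset.replicate q 3) := by
  refine ⟨k • P 3 ∪ q • C 3, ?_, ?_⟩
  · rw [minGraphs, if_neg (by omega), if_pos (by omega), show (k + 3 * q - k) / 3 = q by omega]
    rfl
  · exact ((isModel_smul_path k 3).union (isModel_smul_cycle q 3)).cast (by simp) (by simp)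

theorem minGraphs_terminal_four {k q : ℕ} :
    ∃ F ∈ minGraphs (k + 2 + 3 * q) (k + 1), IsModel F.graph
      ({4} + Multiset.replicate k 3) (Multiset.replicate q 3) := by
  refine ⟨k • P 3 ∪ P 4 ∪ q • C 3, ?_, ?_⟩
  · rw [minGraphs, if_neg (by omega), if_neg (by omega), if_pos (by omega),
      show (k + 2 + 3 * q - (k + 1) - 1) / 3 = q by omega, Nat.add_sub_cancel]
    rfl
  · exact (((isModel_smul_path k 3).union (isModel_path 4)).union
      (isModel_smul_cycle q 3)).cast (by simp [add_comm]) (by simp)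

theorem minGraphs_terminal_five {k q : ℕ} :
    ∃ F ∈ minGraphs (k + 3 + 3 * q) (k + 1), IsModel F.graph
      ({5} + Multiset.replicate k 3) (Multiset.replicate q 3) := by
  refine ⟨k • P 3 ∪ P 5 ∪ q • C 3, ?_, ?_⟩
  · rw [minGraphs, if_neg (by omega), if_neg (by omega), if_neg (by omega),
      show (k + 3 + 3 * q - (k + 1) - 2) / 3 = q by omega, Nat.add_sub_cancel]
    exact Or.inl rfl
  · exact (((isModel_smul_path k 3).union (isModel_path 5)).union
      (isModel_smul_cycle q 3)).cast (by simp [add_comm]) (by simp)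

theorem minGraphs_terminal_two {k q : ℕ} :
    ∃ F ∈ minGraphs (k + 3 * (q + 1)) (k + 1), IsModel F.graph
      (Multiset.replicate k 3 + {2}) (Multiset.replicate (q + 1) 3) := by
  refine ⟨k • P 3 ∪ P 2 ∪ (q + 1) • C 3, ?_, ?_⟩
  · rw [minGraphs, if_neg (by omega), if_neg (by omega), if_neg (by omega),
      show (k + 3 * (q + 1) - (k + 1) + 1) / 3 = q + 1 by omega, Nat.add_sub_cancel]
    exact Or.inr rfl
  · exact (((isModel_smul_path k 3).union (isModel_path 2)).union
      (isModel_smul_cycle (q + 1) 3)).cast (by simp) (by simp)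

/-- If no exchange applies, all cycles are triangles and all paths have at most five vertices. A
path on four or five vertices then forces all the others to be `P 3`; without such a path, at most
one `P 2` can coexist with triangles. -/
theorem exists_minGraph_or_canLower {n k l : ℕ} {ps cs : Multiset ℕ} (h : IsType n k ps cs)
    (hk : 1 ≤ k) (hn : n = 2 * k + l) :
    (∃ F ∈ minGraphs l k, IsModel F.graph ps cs) ∨ CanLower n k ps cs := by
  refine or_iff_not_imp_right.2 fun hno => ?_
  have hc6 : ∀ c ∈ cs, c < 6 := by
    intro c hc
    by_contra hc'
    obtain ⟨t, rfl⟩ := exists_singleton_add_of_mem hc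
    obtain ⟨b, rfl⟩ := Nat.exists_eq_add_of_le' (not_lt.1 hc')
    exact hno (h.canLower 0 ({3} + {b + 3}) (zero_add _).symm rfl (cycle_three_cycle_lt b)
      (by simp) (by simp) rfl (by simp; omega))
  have hp6 : ∀ a ∈ ps, a < 6 := by
    intro a ha
    by_contra ha'
    obtain ⟨t, rfl⟩ := exists_singleton_add_of_mem ha
    obtain ⟨b, rfl⟩ := Nat.exists_eq_add_of_le' (not_lt.1 ha')
    exact hno (h.canLower {b + 3} {3} rfl (zero_add _).symm (path_three_cycle_lt_path b)
      (by simp) (by simp) rfl (by simp))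
  -- Some path is needed to absorb the surplus vertices of a `C 4` or `C 5`; it exists because `1 ≤
  -- k`.
  obtain ⟨a₀, ha₀⟩ : ∃ a, a ∈ ps := by
    apply Multiset.card_pos_iff_exists_mem.1
    rw [h.card_eq]
    omega
  have ha₀5 := hp6 a₀ ha₀
  have ha₀2 := h.two_le a₀ ha₀
  have hc3 : ∀ c ∈ cs, c = 3 := by
    intro c hc
    have h6 := hc6 c hc
    have h3 := h.three_le c hc
    obtain ⟨t, rfl⟩ := exists_singleton_add_of_mem hc
    obtain ⟨u, rfl⟩ := exists_singleton_add_of_mem ha₀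
    by_contra hne
    obtain rfl | rfl : c = 4 ∨ c = 5 := by omega
    · exact hno (h.canLower {a₀ + 1} {3} rfl rfl
        (path_three_cycle_lt_path_cycle_four ha₀2 (by omega)) (by simp; omega) (by simp) rfl
        (by simp))
    · exact hno (h.canLower {a₀ + 2} {3} rfl rfl
        (path_three_cycle_lt_path_cycle_five ha₀2 (by omega)) (by simp) (by simp) rfl
        (by simp))
  obtain ⟨q, rfl⟩ : ∃ q, cs = Multiset.replicate q 3 := ⟨_, Multiset.eq_replicate_card.2 hc3⟩
  have hsum := h.sum_eq
  have hcard := h.card_eq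
  by_cases h4 : ∃ a ∈ ps, 4 ≤ a
  · obtain ⟨a, ha, ha4⟩ := h4
    have ha5 := hp6 a ha
    obtain ⟨t, rfl⟩ := exists_singleton_add_of_mem ha
    have ht : ∀ b ∈ t, b = 3 := by
      intro b hb
      obtain ⟨u, rfl⟩ := exists_singleton_add_of_mem hb
      have hb2 := h.two_le b (by simp)
      by_contra hb3
      obtain ⟨a, rfl⟩ := Nat.exists_eq_add_of_le' ha4
      by_cases hb4 : 4 ≤ b
      · obtain ⟨b, rfl⟩ := Nat.exists_eq_add_of_le' hb4
        exact hno (h.canLower ({3} + {a + b + 5}) 0 (add_assoc _ _ _).symm (zero_add _).symm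
          (path_three_path_lt a b) (by simp) (by simp) rfl (by simp; omega))
      · obtain rfl : b = 2 := by omega
        -- An edge beside a path on `a + 4` vertices becomes `P 3` beside a path on `a + 3`
        -- vertices.
        have := path_path_lt 0 a
        rw [zero_add, zero_add] at this
        exact hno (h.canLower ({3} + {a + 3}) 0 (add_left_comm _ _ _ |>.trans
          (add_assoc _ _ _).symm) (zero_add _).symm this (by simp) (by simp) rfl
          (by simp; omega))
    obtain ⟨r, rfl⟩ : ∃ r, t = Multiset.replicate r 3 := ⟨_, Multiset.eq_replicate_card.2 ht⟩
    simp at hsum hcard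
    obtain rfl : k = r + 1 := by omega
    obtain rfl | rfl : a = 4 ∨ a = 5 := by omega
    · obtain rfl : l = r + 2 + 3 * q := by omega
      exact minGraphs_terminal_four
    · obtain rfl : l = r + 3 + 3 * q := by omega
      exact minGraphs_terminal_five
  · obtain ⟨a, b, rfl⟩ : ∃ a b, ps = Multiset.replicate a 3 + Multiset.replicate b 2 := by
      refine exists_replicate_add_replicate fun x hx => ?_
      have := h.two_le x hx
      have : ¬ 4 ≤ x := fun h' => h4 ⟨x, hx, h'⟩
      omega
    simp at hsum hcard
    subst hcard
    obtain rfl : l = a + 3 * q := by omega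
    obtain _ | q := q
    · simpa using minGraphs_terminal_of_paths
    -- At least one triangle is present here; two edges and a triangle could be exchanged for `P 3 ∪
    -- P 4`, so `b ≤ 1`.
    · match b, h with
      | 0, h => simpa using minGraphs_terminal_zero (k := a) (q := q + 1) (by omega)
      | 1, h => simpa using minGraphs_terminal_two (k := a) (q := q)
      | b + 2, h =>
        refine absurd (h.canLower ({3} + {4}) 0 (A := {2} + {2}) (B := {3})
          (ps := Multiset.replicate a 3 + Multiset.replicate b 2)
          (cs := Multiset.replicate q 3) ?_ ?_
          path_path_lt_path_path_cycle_three (by simp) (by simp) rfl rfl) hno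
        · simp [Multiset.replicate_succ, Multiset.singleton_add, Multiset.cons_add]
        · simp [Multiset.replicate_succ, Multiset.singleton_add]

/-! ### Graphs that no exchange raises. -/

theorem maxGraphs_terminal_zero {k q : ℕ} :
    ∃ H ∈ maxGraphs (4 * q) k, IsModel H.graph
      (Multiset.replicate k 2) (Multiset.replicate q 4) := by
  refine ⟨k • P 2 ∪ q • C 4, ?_, ?_⟩
  · rw [maxGraphs, if_neg (by omega), if_neg (by omega), if_pos (by omega),
      Nat.mul_div_cancel_left _ (by omega)]
    rfl
  · exact ((isModel_smul_path k 2).union (isModel_smul_cycle q 4)).cast (by simp) (by simp)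

theorem maxGraphs_terminal_cycle {k q c : ℕ} (hc : c = 5 ∨ c = 6 ∨ c = 7) :
    ∃ H ∈ maxGraphs (4 * q + c) k, IsModel H.graph
      (Multiset.replicate k 2) ({c} + Multiset.replicate q 4) := by
  refine ⟨k • P 2 ∪ q • C 4 ∪ C c, ?_, ?_⟩
  · rcases hc with rfl | rfl | rfl
    · rw [maxGraphs, if_neg (by omega), if_neg (by omega), if_neg (by omega), if_pos (by omega),
        show (4 * q + 5 - 5) / 4 = q by omega]
      rfl
    · rw [maxGraphs, if_neg (by omega), if_neg (by omega), if_neg (by omega), if_neg (by omega),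
        if_pos (by omega), show (4 * q + 6 - 6) / 4 = q by omega]
      rfl
    · rw [maxGraphs, if_neg (by omega), if_neg (by omega), if_neg (by omega), if_neg (by omega),
        if_neg (by omega), show (4 * q + 7 - 7) / 4 = q by omega]
      rfl
  · exact (((isModel_smul_path k 2).union (isModel_smul_cycle q 4)).union (isModel_cycle c)).cast
      (by simp) (by simp [add_comm])

theorem maxGraphs_terminal_three {k : ℕ} :
    ∃ H ∈ maxGraphs 3 k, IsModel H.graph (Multiset.replicate k 2) {3} :=
  ⟨k • P 2 ∪ C 3, Or.inr rfl,
    ((isModel_smul_path k 2).union (isModel_cycle 3)).cast (by simp) (by simp)⟩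

theorem maxGraphs_terminal_path {k l : ℕ} (hl : l = 2 ∨ l = 3) :
    ∃ H ∈ maxGraphs l (k + 1), IsModel H.graph ({l + 2} + Multiset.replicate k 2) 0 := by
  refine ⟨k • P 2 ∪ P (l + 2), ?_,
    ((isModel_smul_path k 2).union (isModel_path _)).cast (by simp [add_comm]) (by simp)⟩
  rcases hl with rfl | rfl
  · exact rfl
  · exact Or.inl rfl

theorem canRaise_of_path_three_cycle {n k c : ℕ} {ps cs : Multiset ℕ}
    (h : IsType n k ({3} + ps) ({c} + cs)) : CanRaise n k ({3} + ps) ({c} + cs) := by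
  obtain ⟨m, rfl⟩ := Nat.exists_eq_add_of_le' (h.three_le c (by simp))
  exact h.canRaise {2} {m + 4} rfl rfl (path_three_cycle_lt m) (by simp) (by simp) rfl
    (by simp; omega)

theorem canRaise_of_path_four_cycle {n k c : ℕ} {ps cs : Multiset ℕ}
    (h : IsType n k ({4} + ps) ({c} + cs)) : CanRaise n k ({4} + ps) ({c} + cs) := by
  obtain ⟨m, rfl⟩ := Nat.exists_eq_add_of_le' (h.three_le c (by simp))
  exact h.canRaise {2} {m + 5} rfl rfl (path_four_cycle_lt m) (by simp) (by simp) rfl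
    (by simp; omega)

theorem canRaise_of_cycle_cycle {n k c d : ℕ} {ps cs : Multiset ℕ}
    (h : IsType n k ps ({c} + ({d} + cs))) (hc : c ≤ 7) (hd : d ≤ 7)
    (hcd : (c ≠ 4 ∧ d ≠ 4) ∨ (c = 3 ∧ d = 4) ∨ (c = 4 ∧ d = 3)) :
    CanRaise n k ps ({c} + ({d} + cs)) := by
  have hc3 := h.three_le c (by simp)
  have hd3 := h.three_le d (by simp)
  rcases le_total c d with hle | hle
  · obtain ⟨B, hB, hs, hlt⟩ := exists_cycle_cycle_lt hc3 hle hd (by omega)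
    exact h.canRaise 0 B (zero_add _).symm (add_assoc _ _ _).symm hlt (by simp) hB rfl
      (by simp [hs])
  · obtain ⟨B, hB, hs, hlt⟩ := exists_cycle_cycle_lt hd3 hle hc (by omega)
    exact h.canRaise 0 B (zero_add _).symm ((add_left_comm _ _ _).trans (add_assoc _ _ _).symm)
      hlt (by simp) hB rfl (by simp [hs])

/-- A path on five vertices may be exchanged for an edge and a triangle. -/
theorem modelPoly_five (ps cs : Multiset ℕ) :
    modelPoly ({5} + ps) cs = modelPoly ({2} + ps) ({3} + cs) := by
  simp [modelPoly, pathPoly_five]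
  ring

/-- Trading `P 5` for `P 2 ∪ C 3` costs nothing, and the new triangle forms a non-optimal pair with
the cycle `c`. -/
theorem canRaise_of_path_five_cycle {n k c : ℕ} {ps cs : Multiset ℕ}
    (h : IsType n k ({5} + ps) ({c} + cs)) (hc : c ≤ 7) :
    CanRaise n k ({5} + ps) ({c} + cs) := by
  have h' : IsType n k ({2} + ps) ({3} + ({c} + cs)) := by
    have := IsType.replace (A := {5}) (A' := {2}) (B := 0) (B' := {3}) (ps := ps)
      (cs := {c} + cs) (by rwa [zero_add]) (by simp) (by simp) rfl rfl
    exact this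
  obtain ⟨qs, ds, h1, h2⟩ := canRaise_of_cycle_cycle h' (by omega) hc (by omega)
  exact ⟨qs, ds, h1, by rwa [modelPoly_five]⟩

/-- If no exchange applies, at most one path is longer than an edge, and it excludes all cycles. If
all paths are edges, at most one cycle differs from `C 4`, and a triangle must be the only cycle. -/
theorem exists_maxGraph_or_canRaise {n k l : ℕ} {ps cs : Multiset ℕ} (h : IsType n k ps cs)
    (hk : 1 ≤ k) (hl : 2 ≤ l) (hn : n = 2 * k + l) :
    (∃ H ∈ maxGraphs l k, IsModel H.graph ps cs) ∨ CanRaise n k ps cs := by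
  refine or_iff_not_imp_right.2 fun hno => ?_
  have hc7 : ∀ c ∈ cs, c ≤ 7 := by
    intro c hc
    by_contra! hc'
    obtain ⟨t, rfl⟩ := exists_singleton_add_of_mem hc
    obtain ⟨b, rfl⟩ := Nat.exists_eq_add_of_le' hc'
    exact hno (h.canRaise 0 ({4} + {b + 4}) (zero_add _).symm rfl (cycle_lt_cycle_cycle b)
      (by simp) (by simp) rfl (by simp; omega))
  have hp5 : ∀ a ∈ ps, a ≤ 5 := by
    intro a ha
    by_contra! ha'
    obtain ⟨t, rfl⟩ := exists_singleton_add_of_mem ha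
    obtain ⟨b, rfl⟩ := Nat.exists_eq_add_of_le' ha'
    exact hno (h.canRaise {2} {b + 4} rfl (zero_add _).symm (path_lt_path_cycle b)
      (by simp) (by simp) rfl (by simp; omega))
  have hsum := h.sum_eq
  have hcard := h.card_eq
  rcases eq_replicate_or_exists_add (s := ps) 2 with ⟨r, rfl⟩ | ⟨a, t, ha2, rfl⟩
  · rcases eq_replicate_or_exists_add (s := cs) 4 with ⟨q, rfl⟩ | ⟨c, u, hc4, rfl⟩
    · simp at hsum hcard
      subst hcard
      obtain rfl : l = 4 * q := by omega
      exact maxGraphs_terminal_zero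
    · have hc7' := hc7 c (by simp)
      have hc3 := h.three_le c (by simp)
      obtain ⟨q, rfl⟩ : ∃ q, u = Multiset.replicate q 4 := by
        refine ⟨_, Multiset.eq_replicate_card.2 fun d hd => ?_⟩
        by_contra hd4
        have hd7 := hc7 d (by simp [hd])
        obtain ⟨v, rfl⟩ := exists_singleton_add_of_mem hd
        exact hno (canRaise_of_cycle_cycle h hc7' hd7 (Or.inl ⟨hc4, hd4⟩))
      simp at hsum hcard
      subst hcard
      obtain rfl : l = 4 * q + c := by omega
      by_cases hc : c = 3
      · subst hc
        obtain _ | q := q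
        · simpa using maxGraphs_terminal_three
        · rw [Multiset.replicate_succ, ← Multiset.singleton_add] at h hno
          exact absurd (canRaise_of_cycle_cycle h (by omega) (by omega) (by omega)) hno
      · exact maxGraphs_terminal_cycle (by omega)
  · have ha5 := hp5 a (by simp)
    have ha2' := h.two_le a (by simp)
    obtain ⟨r, rfl⟩ : ∃ r, t = Multiset.replicate r 2 := by
      refine ⟨_, Multiset.eq_replicate_card.2 fun b hb => ?_⟩
      by_contra hb2
      have hb2' := h.two_le b (by simp [hb])
      obtain ⟨v, rfl⟩ := exists_singleton_add_of_mem hb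
      obtain ⟨a, rfl⟩ := Nat.exists_eq_add_of_le' (show 3 ≤ a by omega)
      obtain ⟨b, rfl⟩ := Nat.exists_eq_add_of_le' (show 3 ≤ b by omega)
      exact hno (h.canRaise ({2} + {a + b + 4}) 0 (add_assoc _ _ _).symm (zero_add _).symm
        (path_path_lt a b) (by simp) (by simp) rfl (by simp; omega))
    obtain rfl : cs = 0 := by
      by_contra hne
      obtain ⟨c, hc⟩ := Multiset.exists_mem_of_ne_zero hne
      have hc7' := hc7 c hc
      obtain ⟨u, rfl⟩ := exists_singleton_add_of_mem hc
      obtain rfl | rfl | rfl : a = 3 ∨ a = 4 ∨ a = 5 := by omega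
      · exact hno (canRaise_of_path_three_cycle h)
      · exact hno (canRaise_of_path_four_cycle h)
      · exact hno (canRaise_of_path_five_cycle h hc7')
    simp at hsum hcard
    obtain rfl : k = r + 1 := by omega
    obtain rfl : a = l + 2 := by omega
    -- The single long path has `l + 2` vertices and at most five, so `l` is 2 or 3.
    exact maxGraphs_terminal_path (by omega)

end FinGraph

/-! ### The listed graphs: their types and the equality of their polynomials. -/

namespace FinGraph

theorem IsModel.graphPoly_eq_modelPoly {V : Type*} [Finite V] {G : SimpleGraph V}
    {ps cs : Multiset ℕ} {n k : ℕ} (h : IsModel G ps cs) (ht : IsType n k ps cs) :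
    graphPoly G = modelPoly ps cs := h.graphPoly_eq ht.three_le

theorem IsModel.inOmega_of_isType {V : Type*} [Fintype V] {G : SimpleGraph V}
    {ps cs : Multiset ℕ} {n k : ℕ} (h : IsModel G ps cs) (ht : IsType n k ps cs) :
    InOmega n k G := by
  have := h.inOmega ht.two_le ht.three_le
  rwa [ht.card_eq, ht.sum_eq] at this

/-- One shape covers every listed graph: repeated components plus exceptional paths `s` and cycles
`t`. Unused slots get multiplicity 0. -/
theorem isType_replicate {n k a x b y c z : ℕ} {s t : Multiset ℕ}
    (hs : ∀ i ∈ s, 2 ≤ i) (ht : ∀ i ∈ t, 3 ≤ i)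
    (hx : 2 ≤ x) (hy : 2 ≤ y) (hz : 3 ≤ z) (hk : s.card + a + b = k)
    (hn : s.sum + a * x + b * y + t.sum + c * z = n) :
    IsType n k (Multiset.replicate a x + Multiset.replicate b y + s)
      (Multiset.replicate c z + t) := by
  refine ⟨?_, ?_, ?_, ?_⟩
  · intro i hi
    simp only [Multiset.mem_add, Multiset.mem_replicate] at hi
    rcases hi with (⟨-, rfl⟩ | ⟨-, rfl⟩) | hi
    exacts [hx, hy, hs i hi]
  · intro i hi
    simp only [Multiset.mem_add, Multiset.mem_replicate] at hi
    rcases hi with ⟨-, rfl⟩ | hi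
    exacts [hz, ht i hi]
  · simp
    omega
  · simp
    omega

theorem exists_isType_of_mem_minGraphs {l k : ℕ} (hk : 1 ≤ k) {F : FinGraph}
    (hF : F ∈ minGraphs l k) : ∃ ps cs, IsType (2 * k + l) k ps cs ∧ IsModel F.graph ps cs := by
  rw [minGraphs] at hF
  split_ifs at hF with h1 h2 h3
  · obtain rfl := hF
    exact ⟨_, _, isType_replicate (s := 0) (t := 0) (a := l) (x := 3) (b := k - l) (y := 2)
      (c := 0) (z := 3) (by simp) (by simp) (by omega) (by omega) (by omega) (by simp; omega)
      (by simp; omega), ((isModel_smul_path l 3).union (isModel_smul_path (k - l) 2)).cast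
        (by simp) (by simp)⟩
  · obtain rfl := hF
    exact ⟨_, _, isType_replicate (s := 0) (t := 0) (a := k) (x := 3) (b := 0) (y := 2)
      (c := (l - k) / 3) (z := 3) (by simp) (by simp) (by omega) (by omega) (by omega) (by simp)
      (by simp; omega), ((isModel_smul_path k 3).union (isModel_smul_cycle _ 3)).cast
        (by simp) (by simp)⟩
  · obtain rfl := hF
    exact ⟨_, _, isType_replicate (s := {4}) (t := 0) (a := k - 1) (x := 3) (b := 0) (y := 2)
      (c := (l - k - 1) / 3) (z := 3) (by simp) (by simp) (by omega) (by omega) (by omega)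
      (by simp; omega) (by simp; omega),
      (((isModel_smul_path (k - 1) 3).union (isModel_path 4)).union
        (isModel_smul_cycle _ 3)).cast (by simp) (by simp)⟩
  · rcases hF with rfl | rfl
    · exact ⟨_, _, isType_replicate (s := {5}) (t := 0) (a := k - 1) (x := 3) (b := 0) (y := 2)
        (c := (l - k - 2) / 3) (z := 3) (by simp) (by simp) (by omega) (by omega) (by omega)
        (by simp; omega) (by simp; omega),
        (((isModel_smul_path (k - 1) 3).union (isModel_path 5)).union
          (isModel_smul_cycle _ 3)).cast (by simp) (by simp)⟩
    · exact ⟨_, _, isType_replicate (s := {2}) (t := 0) (a := k - 1) (x := 3) (b := 0) (y := 2)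
        (c := (l - k + 1) / 3) (z := 3) (by simp) (by simp) (by omega) (by omega) (by omega)
        (by simp; omega) (by simp; omega),
        (((isModel_smul_path (k - 1) 3).union (isModel_path 2)).union
          (isModel_smul_cycle _ 3)).cast (by simp) (by simp)⟩

theorem exists_isType_of_mem_maxGraphs {l k : ℕ} (hk : 1 ≤ k) (hl : 2 ≤ l) {H : FinGraph}
    (hH : H ∈ maxGraphs l k) : ∃ ps cs, IsType (2 * k + l) k ps cs ∧ IsModel H.graph ps cs := by
  have hpath : ∀ a, a = l + 2 → ∃ ps cs, IsType (2 * k + l) k ps cs ∧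
      IsModel ((k - 1) • P 2 ∪ P a).graph ps cs := fun a ha =>
    ⟨_, _, isType_replicate (s := {a}) (t := 0) (a := k - 1) (x := 2) (b := 0) (y := 2)
      (c := 0) (z := 4) (by simp; omega) (by simp) (by omega) (by omega) (by omega)
      (by simp; omega) (by simp; omega),
      ((isModel_smul_path (k - 1) 2).union (isModel_path a)).cast (by simp) (by simp)⟩
  have hcycle : ∀ q c, 3 ≤ c → l = 4 * q + c → ∃ ps cs, IsType (2 * k + l) k ps cs ∧
      IsModel (k • P 2 ∪ q • C 4 ∪ C c).graph ps cs := fun q c hc hq =>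
    ⟨_, _, isType_replicate (s := 0) (t := {c}) (a := k) (x := 2) (b := 0) (y := 2)
      (c := q) (z := 4) (by simp) (by simpa) (by omega) (by omega) (by omega)
      (by simp) (by simp; omega),
      (((isModel_smul_path k 2).union (isModel_smul_cycle q 4)).union (isModel_cycle c)).cast
        (by simp) (by simp)⟩
  rw [maxGraphs] at hH
  split_ifs at hH with h1 h2 h3 h4 h5
  · obtain rfl := hH
    exact hpath 4 (by omega)
  · rcases hH with rfl | rfl
    · exact hpath 5 (by omega)
    · exact ⟨_, _, isType_replicate (s := 0) (t := {3}) (a := k) (x := 2) (b := 0) (y := 2)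
        (c := 0) (z := 4) (by simp) (by simp) (by omega) (by omega) (by omega)
        (by simp) (by simp; omega),
        ((isModel_smul_path k 2).union (isModel_cycle 3)).cast (by simp) (by simp)⟩
  · obtain rfl := hH
    exact ⟨_, _, isType_replicate (s := 0) (t := 0) (a := k) (x := 2) (b := 0) (y := 2)
      (c := l / 4) (z := 4) (by simp) (by simp) (by omega) (by omega) (by omega)
      (by simp) (by simp; omega),
      ((isModel_smul_path k 2).union (isModel_smul_cycle _ 4)).cast (by simp) (by simp)⟩
  · obtain rfl := hH
    exact hcycle _ 5 (by omega) (by omega)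
  · obtain rfl := hH
    exact hcycle _ 6 (by omega) (by omega)
  · obtain rfl := hH
    exact hcycle _ 7 (by omega) (by omega)

theorem graphPoly_union (F H : FinGraph) :
    graphPoly (F ∪ H).graph = graphPoly F.graph * graphPoly H.graph :=
  graphPoly_sum F.graph H.graph

theorem graphPoly_smul_succ (q : ℕ) (F : FinGraph) :
    graphPoly ((q + 1) • F).graph = graphPoly (q • F).graph * graphPoly F.graph :=
  graphPoly_sum (q • F).graph F.graph

theorem graphPoly_path_five :
    graphPoly (P 5).graph = graphPoly (P 2).graph * graphPoly (C 3).graph :=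
  (graphPoly_pathGraph 5).trans (pathPoly_five.trans
    (congrArg₂ _ (graphPoly_pathGraph 2).symm (graphPoly_cycleGraph le_rfl).symm))

theorem graphPoly_eq_of_mem_minGraphs {l k : ℕ} {F F' : FinGraph} (hF : F ∈ minGraphs l k)
    (hF' : F' ∈ minGraphs l k) : graphPoly F.graph = graphPoly F'.graph := by
  rw [minGraphs] at hF hF'
  split_ifs at hF hF' with h1 h2 h3
  · rw [hF, hF']
  · rw [hF, hF']
  · rw [hF, hF']
  · have key : graphPoly ((k - 1) • P 3 ∪ P 5 ∪ ((l - k - 2) / 3) • C 3).graph =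
        graphPoly ((k - 1) • P 3 ∪ P 2 ∪ ((l - k + 1) / 3) • C 3).graph := by
      -- The second graph has exactly one triangle more, which is traded with its `P 2` for the `P
      -- 5`.
      rw [show (l - k + 1) / 3 = (l - k - 2) / 3 + 1 by omega, graphPoly_union, graphPoly_union,
        graphPoly_union, graphPoly_union, graphPoly_smul_succ, graphPoly_path_five]
      ring
    rcases hF with rfl | rfl <;> rcases hF' with rfl | rfl
    exacts [rfl, key, key.symm, rfl]

theorem graphPoly_eq_of_mem_maxGraphs {l k : ℕ} (hk : 1 ≤ k) {H H' : FinGraph}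
    (hH : H ∈ maxGraphs l k) (hH' : H' ∈ maxGraphs l k) :
    graphPoly H.graph = graphPoly H'.graph := by
  rw [maxGraphs] at hH hH'
  split_ifs at hH hH' with h1 h2 h3 h4 h5
  · rw [hH, hH']
  · have key : graphPoly ((k - 1) • P 2 ∪ P 5).graph = graphPoly (k • P 2 ∪ C 3).graph := by
      obtain ⟨k, rfl⟩ := Nat.exists_eq_add_of_le' hk
      rw [Nat.add_sub_cancel, graphPoly_union, graphPoly_union, graphPoly_smul_succ,
        graphPoly_path_five]
      ring
    rcases hH with rfl | rfl <;> rcases hH' with rfl | rfl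
    exacts [rfl, key, key.symm, rfl]
  all_goals rw [hH, hH']

end FinGraph

/-! ### Termination of the exchanges and the conclusion. -/

open FinGraph

theorem eval_pathPoly_le (n : ℕ) : (pathPoly n).eval 1 ≤ 2 ^ n := by
  induction n using Nat.twoStepInduction with
  | zero => simp [pathPoly]
  | one => simp [pathPoly]
  | more n ih1 ih2 =>
    simp only [pathPoly, eval_add, eval_mul, eval_X, pow_succ] at *
    omega

theorem eval_cyclePoly_le (n : ℕ) : (cyclePoly n).eval 1 ≤ 2 * 2 ^ n := by
  induction n using Nat.twoStepInduction with
  | zero => simp [cyclePoly]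
  | one => simp [cyclePoly]
  | more n ih1 ih2 =>
    simp only [cyclePoly, eval_add, eval_mul, eval_X, pow_succ] at *
    omega

theorem eval_multiset_prod_le {s : Multiset ℕ} {f : ℕ → ℕ[X]}
    (h : ∀ a ∈ s, (f a).eval 1 ≤ 4 ^ a) : ((s.map f).prod).eval 1 ≤ 4 ^ s.sum := by
  induction s using Multiset.induction with
  | empty => simp
  | cons a s ih =>
    rw [Multiset.map_cons, Multiset.prod_cons, Multiset.sum_cons, eval_mul, pow_add]
    exact Nat.mul_le_mul (h a (by simp)) (ih fun b hb => h b (by simp [hb]))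

/-- A crude bound on the number of matchings; it only has to be uniform over `Ω(n, k)`, so that
raising must stop. -/
theorem IsType.eval_modelPoly_le {n k : ℕ} {ps cs : Multiset ℕ} (h : IsType n k ps cs) :
    (modelPoly ps cs).eval 1 ≤ 4 ^ n := by
  rw [← h.sum_eq, modelPoly, eval_mul, pow_add]
  refine Nat.mul_le_mul (eval_multiset_prod_le fun a _ => ?_) (eval_multiset_prod_le fun a ha => ?_)
  · exact (eval_pathPoly_le a).trans (Nat.pow_le_pow_left (by omega) a)
  · refine (eval_cyclePoly_le a).trans ?_
    rw [← pow_succ', show 4 = 2 ^ 2 from rfl, ← pow_mul]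
    exact Nat.pow_le_pow_right (by omega) (by have := h.three_le a ha; omega)

/-- Strong induction on the total number of matchings. The model alternative survives only if no
exchange was made, which gives strictness for unlisted graphs. -/
theorem IsType.exists_minGraph {n k l : ℕ} {ps cs : Multiset ℕ} (h : IsType n k ps cs)
    (hk : 1 ≤ k) (hn : n = 2 * k + l) : ∃ F ∈ minGraphs l k, IsModel F.graph ps cs ∨
      PolyLT (graphPoly F.graph) (modelPoly ps cs) := by
  induction hN : (modelPoly ps cs).eval 1 using Nat.strong_induction_on generalizing ps cs with
  | _ N ih =>
    rcases exists_minGraph_or_canLower h hk hn with ⟨F, hF, hm⟩ | ⟨qs, ds, h', hlt⟩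
    · exact ⟨F, hF, Or.inl hm⟩
    · obtain ⟨F, hF, hm⟩ := ih _ (hN ▸ hlt.eval_lt) h' rfl
      refine ⟨F, hF, Or.inr ?_⟩
      rcases hm with hm | hm
      · rwa [hm.graphPoly_eq_modelPoly h']
      · exact hm.trans hlt

theorem IsType.exists_maxGraph {n k l : ℕ} {ps cs : Multiset ℕ} (h : IsType n k ps cs)
    (hk : 1 ≤ k) (hl : 2 ≤ l) (hn : n = 2 * k + l) : ∃ H ∈ maxGraphs l k, IsModel H.graph ps cs ∨
      PolyLT (modelPoly ps cs) (graphPoly H.graph) := by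
  induction hN : 4 ^ n - (modelPoly ps cs).eval 1 using Nat.strong_induction_on
    generalizing ps cs with
  | _ N ih =>
    rcases exists_maxGraph_or_canRaise h hk hl hn with ⟨H, hH, hm⟩ | ⟨qs, ds, h', hlt⟩
    · exact ⟨H, hH, Or.inl hm⟩
    · have h1 := hlt.eval_lt
      have h2 := h'.eval_modelPoly_le
      obtain ⟨H, hH, hm⟩ := ih _ (by omega) h' rfl
      refine ⟨H, hH, Or.inr ?_⟩
      rcases hm with hm | hm
      · rwa [hm.graphPoly_eq_modelPoly h']
      · exact hlt.trans hm

theorem matchingGenPoly_eq_map {V : Type*} [Fintype V] (G : SimpleGraph V) :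
    matchingGenPoly G = (graphPoly G).map (Nat.castRingHom ℝ) := by
  ext m
  rw [coeff_map, coeff_graphPoly, matchingGenPoly, finsetSum_coeff]
  simp only [coeff_C_mul, coeff_X_pow, mul_ite, mul_one, mul_zero, Finset.sum_ite_eq,
    Finset.mem_range, eq_natCast]
  split_ifs with h
  · rfl
  · rw [numMatchings_eq_zero G (by omega), Nat.cast_zero]

theorem coeffLE_of_eq_add {V W : Type*} [Fintype V] [Fintype W] {G : SimpleGraph V}
    {H : SimpleGraph W} {r : ℕ[X]} (h : graphPoly H = graphPoly G + r) :
    CoeffLE (matchingGenPoly G) (matchingGenPoly H) := by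
  intro i
  rw [matchingGenPoly_eq_map, matchingGenPoly_eq_map, h, Polynomial.map_add, add_sub_cancel_left,
    coeff_map]
  exact Nat.cast_nonneg _

theorem numMatchings_le_of_eq_add {V W : Type*} [Finite V] [Finite W] {G : SimpleGraph V}
    {H : SimpleGraph W} {r : ℕ[X]} (h : graphPoly H = graphPoly G + r) (m : ℕ) :
    numMatchings m G ≤ numMatchings m H := by
  rw [← coeff_graphPoly, ← coeff_graphPoly, h, coeff_add]
  exact Nat.le_add_right _ _

theorem PolyLT.coeffLT {V W : Type*} [Fintype V] [Fintype W] {G : SimpleGraph V}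
    {H : SimpleGraph W} (h : PolyLT (graphPoly G) (graphPoly H)) :
    CoeffLT (matchingGenPoly G) (matchingGenPoly H) := by
  refine ⟨coeffLE_of_eq_add h.choose_spec.2, fun heq => ?_⟩
  rw [matchingGenPoly_eq_map, matchingGenPoly_eq_map] at heq
  have := Polynomial.map_injective (Nat.castRingHom ℝ) Nat.cast_injective heq
  exact absurd h.eval_lt (by rw [this]; exact lt_irrefl _)

/-- When at most one vertex has degree `2`, there are only paths on two and three vertices. -/
theorem IsType.eq_of_lt_two {k l : ℕ} {ps cs : Multiset ℕ} (h : IsType (2 * k + l) k ps cs)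
    (hl : l < 2) :
    ps = Multiset.replicate l 3 + Multiset.replicate (k - l) 2 ∧ cs = 0 := by
  -- The `k` paths already use `2 * k` vertices, so a surplus below 2 admits no cycle and at most
  -- one extra vertex on one path.
  have hps : ∀ s : Multiset ℕ, (∀ a ∈ s, 2 ≤ a) → 2 * s.card ≤ s.sum := fun s hs => by
    simpa [mul_comm] using Multiset.card_nsmul_le_sum hs
  have hsum := h.sum_eq
  have hcard := h.card_eq
  have h0 := hps ps h.two_le
  have hc : cs = 0 := by
    by_contra hne
    obtain ⟨c, hc⟩ := Multiset.exists_mem_of_ne_zero hne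
    have h1 := h.three_le c hc
    have h2 := Multiset.le_sum_of_mem hc
    omega
  subst hc
  obtain ⟨a, b, rfl⟩ : ∃ a b, ps = Multiset.replicate a 3 + Multiset.replicate b 2 := by
    refine exists_replicate_add_replicate fun x hx => ?_
    obtain ⟨t, rfl⟩ := exists_singleton_add_of_mem hx
    have h1 := hps t fun y hy => h.two_le y (by simp [hy])
    have h2 := h.two_le x (by simp)
    simp at hsum hcard
    omega
  simp at hsum hcard
  obtain rfl : a = l := by omega
  obtain rfl : b = k - a := by omega
  exact ⟨rfl, rfl⟩

theorem mainTheorem1 (n k l : ℕ) (hk : 2 ≤ 2 * k) (hkn : 2 * k ≤ n) (hl : l = n - 2 * k) :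
    -- for `l < 2` the class `Ω(n, k)` consists of one graph up to isomorphism
    (l < 2 → ∃ G₀ : FinGraph, InOmega n k G₀.graph ∧
      ∀ (V : Type*) [Fintype V] (G : SimpleGraph V), InOmega n k G → Nonempty (G ≃g G₀.graph)) ∧
    -- for `l ≥ 2` the graphs `F` and `H` are the extremal elements of `Ω(n, k)`
    (2 ≤ l →
      (∀ F ∈ FinGraph.minGraphs l k, InOmega n k F.graph) ∧
      (∀ H ∈ FinGraph.maxGraphs l k, InOmega n k H.graph) ∧
      ∀ (V : Type*) [Fintype V] (G : SimpleGraph V), InOmega n k G →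
        (∀ F ∈ FinGraph.minGraphs l k,
          CoeffLE (matchingGenPoly F.graph) (matchingGenPoly G) ∧
          (∀ m : ℕ, numMatchings m F.graph ≤ numMatchings m G) ∧
          (¬ FinGraph.IsOneOf G (FinGraph.minGraphs l k) →
            CoeffLT (matchingGenPoly F.graph) (matchingGenPoly G))) ∧
        (∀ H ∈ FinGraph.maxGraphs l k,
          CoeffLE (matchingGenPoly G) (matchingGenPoly H.graph) ∧
          (∀ m : ℕ, numMatchings m G ≤ numMatchings m H.graph) ∧
          (¬ FinGraph.IsOneOf G (FinGraph.maxGraphs l k) →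
            CoeffLT (matchingGenPoly G) (matchingGenPoly H.graph)))) := by
  obtain rfl : n = 2 * k + l := by omega
  have hk1 : 1 ≤ k := by omega
  refine ⟨fun hl2 => ?_, fun hl2 => ⟨fun F hF => ?_, fun H hH => ?_, fun V _ G hG => ?_⟩⟩
  · have hF : l • P 3 ∪ (k - l) • P 2 ∈ minGraphs l k := by
      rw [minGraphs, if_pos (by omega)]
      rfl
    obtain ⟨ps, cs, ht, hm⟩ := exists_isType_of_mem_minGraphs hk1 hF
    refine ⟨_, hm.inOmega_of_isType ht, fun V _ G hG => ?_⟩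
    obtain ⟨qs, ds, h1, h2, h3, h4, hm'⟩ := hG.exists_isModel
    obtain ⟨rfl, rfl⟩ := (IsType.mk h1 h2 h3 h4).eq_of_lt_two hl2
    obtain ⟨rfl, rfl⟩ := ht.eq_of_lt_two hl2
    exact hm'.iso hm
  · obtain ⟨ps, cs, ht, hm⟩ := exists_isType_of_mem_minGraphs hk1 hF
    exact hm.inOmega_of_isType ht
  · obtain ⟨ps, cs, ht, hm⟩ := exists_isType_of_mem_maxGraphs hk1 hl2 hH
    exact hm.inOmega_of_isType ht
  · obtain ⟨ps, cs, h1, h2, h3, h4, hm⟩ := hG.exists_isModel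
    have ht : IsType (2 * k + l) k ps cs := ⟨h1, h2, h3, h4⟩
    have hGp := hm.graphPoly_eq_modelPoly ht
    constructor
    · intro F hF
      obtain ⟨F', hF', h⟩ := ht.exists_minGraph hk1 rfl
      -- The descent may end at another listed graph `F'` than the given `F`, but their polynomials
      -- are equal.
      rw [← hGp, graphPoly_eq_of_mem_minGraphs hF' hF] at h
      have hadd : ∃ r, graphPoly G = graphPoly F.graph + r := by
        rcases h with h | ⟨r, -, h⟩
        · exact ⟨0, by rw [add_zero, graphPoly_eq_of_mem_minGraphs hF hF',
            graphPoly_congr (hm.iso h).some]⟩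
        · exact ⟨r, h⟩
      obtain ⟨r, hr⟩ := hadd
      refine ⟨coeffLE_of_eq_add hr, numMatchings_le_of_eq_add hr, fun hno => ?_⟩
      exact (h.resolve_left fun h => hno ⟨F', hF', hm.iso h⟩).coeffLT
    · intro H hH
      obtain ⟨H', hH', h⟩ := ht.exists_maxGraph hk1 hl2 rfl
      rw [← hGp, graphPoly_eq_of_mem_maxGraphs hk1 hH' hH] at h
      have hadd : ∃ r, graphPoly H.graph = graphPoly G + r := by
        rcases h with h | ⟨r, -, h⟩
        · exact ⟨0, by rw [add_zero, graphPoly_eq_of_mem_maxGraphs hk1 hH hH',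
            graphPoly_congr (hm.iso h).some]⟩
        · exact ⟨r, h⟩
      obtain ⟨r, hr⟩ := hadd
      refine ⟨coeffLE_of_eq_add hr, numMatchings_le_of_eq_add hr, fun hno => ?_⟩
      exact (h.resolve_left fun h => hno ⟨H', hH', hm.iso h⟩).coeffLT
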